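/- Let $\mathcal T$ be a locally finite face-to-face tiling of $\mathbb E^d$ ($d\ge 0$) by $d$-dimensional convex polyhedra (each cell is an intersection of finitely many closed half-spaces; in particular the cells may be convex polytopes). Cells are \emph{adjacent} if they share a $(d-1)$-face. Let $s$ be a \emph{canonical scaling} of $\mathcal T$: a function assigning a positive number to every $(d-1)$-face, such that for every $(d-2)$-face $F$ $$\sum_{i} s(F_i)\,\mathbf n_i=0,$$ where $F_1,\dots,F_k$ are all the $(d-1)$-faces of $\mathcal T$ containing $F$ and $\mathbf n_i$ is the unit normal to $F_i$ pointing in a fixed direction of going around $F$ (a fixed orientation of the plane orthogonal to $F$). Embed $\mathbb E^d$ in $\mathbb E^{d+1}=\mathbb E^d\times\mathbb R$ as the hyperplane $x_{d+1}=0$. A \emph{lift} of a cell $P$ is a $d$-dimensional convex polyhedron in $\mathbb E^{d+1}$ whose orthogonal projection to $\mathbb E^d$ is $P$. Fix a cell $P_0\in\mathcal T$. For every chain $[P_0,P_1,\dots,P_k]$ of successively adjacent cells define lifts inductively: $L[P_0]=P_0$ with normal vector $(0,\dots,0,-1)$; and $L[P_0,\dots,P_k]$ is the lift of $P_k$ that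 meets $L[P_0,\dots,P_{k-1}]$ in a common face projecting onto $P_{k-1}\cap P_k$ and whose normal vector is the normal vector of $L[P_0,\dots,P_{k-1}]$ plus $s(P_{k-1}\cap P_k)\,\mathbf n_{k-1,k}$, where $\mathbf n_{k-1,k}\in\mathbb E^d$ is the unit normal to $P_{k-1}\cap P_k$ directed from $P_{k-1}$ to $P_k$. The \emph{generatrix} $\mathcal G_{\mathcal T}$ is the union of all the lifts $L[P_0,\dots,P_k]$, which are called its $d$-faces. Then there is a function $G:\mathbb E^d\to\mathbb R$ such that $\mathcal G_{\mathcal T}$ is the graph of $G$, and for every cell $P\in\mathcal T$ the part of this graph over $P$ is the one and only $d$-face of $\mathcal G_{\mathcal T}$ that is a lift of $P$. The function $G$ is continuous, convex and piecewise linear (it is affine on every cell of $\mathcal T$). Consequently $\mathcal G_{\mathcal T}$ is the boundary of a convex $(d+1)$-dimensional polyhedron, namely of the epigraph $\{(x,y)\in\mathbb E^d\times\mathbb R : y\ge G(x)\}$, which is a closed convex set with nonempty interior that coincides inside every ball with an intersection of finitely many closed half-spaces. -/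

import Mathlib

open scoped InnerProductSpace

/-- `E^d`. -/
abbrev Ed (d : ℕ) : Type := EuclideanSpace ℝ (Fin d)

/-- `E^{d+1} = E^d × ℝ` with the Euclidean (ℓ²) inner product. -/
abbrev Ed1 (d : ℕ) : Type := WithLp 2 (Ed d × ℝ)

section General

variable {V : Type*} [NormedAddCommGroup V] [InnerProductSpace ℝ V]

/-- A convex polyhedron: an intersection of finitely many closed half-spaces
(bounded ones are the convex polytopes). -/
def IsConvexPolyhedron (P : Set V) : Prop :=
  ∃ A : Finset (V × ℝ), P = {x | ∀ a ∈ A, ⟪a.1, x⟫_ℝ ≤ a.2}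

/-- A convex polyhedron with possibly infinitely many, but locally finitely many, faces:
a closed convex set which coincides inside every ball with a finite intersection of closed
half-spaces. -/
def IsLocallyFiniteConvexPolyhedron (K : Set V) : Prop :=
  IsClosed K ∧ Convex ℝ K ∧
    ∀ r : ℝ, ∃ Q : Set V, IsConvexPolyhedron Q ∧
      K ∩ Metric.ball 0 r = Q ∩ Metric.ball 0 r

/-- The dimension of (the affine hull of) a nonempty set. -/
noncomputable def affDim (F : Set V) : ℕ := Module.finrank ℝ (vectorSpan ℝ F)

/-- `h` is a nonzero vector orthogonal to the affine hull of `F`. -/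
def IsNormalTo (h : V) (F : Set V) : Prop :=
  h ≠ 0 ∧ ∀ v ∈ vectorSpan ℝ F, ⟪h, v⟫_ℝ = 0

end General

/-- A locally finite normal (face-to-face) tiling of `E^d` by `d`-dimensional convex polyhedra.
Faces are exposed subsets; the empty set counts as exposed. -/
structure IsNormalTiling {d : ℕ} (T : Set (Set (Ed d))) : Prop where
  polyhedron : ∀ P ∈ T, IsConvexPolyhedron P
  fullDim : ∀ P ∈ T, (interior P).Nonempty
  cover : ⋃₀ T = Set.univ
  disjoint : ∀ P ∈ T, ∀ Q ∈ T, P ≠ Q → Disjoint (interior P) (interior Q)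
  faceToFace : ∀ P ∈ T, ∀ Q ∈ T, IsExposed ℝ P (P ∩ Q) ∧ IsExposed ℝ Q (P ∩ Q)
  locallyFinite : LocallyFinite (fun P : T => (P : Set (Ed d)))

/-- `F` is a (nonempty) face of the tiling. -/
def IsTilingFace {d : ℕ} (T : Set (Set (Ed d))) (F : Set (Ed d)) : Prop :=
  F.Nonempty ∧ ∃ P ∈ T, IsExposed ℝ P F

/-- `(d-1)`-dimensional faces of the tiling. -/
def IsTilingFacet {d : ℕ} (T : Set (Set (Ed d))) (H : Set (Ed d)) : Prop :=
  IsTilingFace T H ∧ affDim H + 1 = d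

/-- `(d-2)`-dimensional faces of the tiling. -/
def IsTilingRidge {d : ℕ} (T : Set (Set (Ed d))) (F : Set (Ed d)) : Prop :=
  IsTilingFace T F ∧ affDim F + 2 = d

/-- `e₁, e₂` is an orthonormal frame of the plane orthogonal to the `(d-2)`-face `F`; the turn from
`e₁` to `e₂` fixes a direction of going around `F`. -/
def IsTraversalFrame {d : ℕ} (F : Set (Ed d)) (e₁ e₂ : Ed d) : Prop :=
  ‖e₁‖ = 1 ∧ ‖e₂‖ = 1 ∧ ⟪e₁, e₂⟫_ℝ = 0 ∧
    ∀ v ∈ vectorSpan ℝ F, ⟪e₁, v⟫_ℝ = 0 ∧ ⟪e₂, v⟫_ℝ = 0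

/-- `n` is the unit normal to the facet `H ⊇ F` agreeing with the direction of going around the
`(d-2)`-face `F` given by the frame `e₁, e₂`. The projection of `H` along `F` to the plane of
`e₁, e₂` lies on the ray spanned by the unit vector `a e₁ + b e₂` starting at the projection of `F`,
and `n` is this unit vector turned by a right angle in the direction from `e₁` to `e₂`. -/
def IsTraversalNormal {d : ℕ} (F : Set (Ed d)) (e₁ e₂ : Ed d) (H : Set (Ed d)) (n : Ed d) : Prop :=
  ∃ a b : ℝ, a ^ 2 + b ^ 2 = 1 ∧
    (∀ x ∈ F, ∀ y ∈ H, ∃ t : ℝ, 0 ≤ t ∧ y - x - t • (a • e₁ + b • e₂) ∈ vectorSpan ℝ F) ∧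
    n = (-b) • e₁ + a • e₂

/-- The torsion of `s` around `F` (the sum, over all facets containing `F`, of `s` times the unit
normal), for a given choice `n` of unit normals. -/
noncomputable def torsion {d : ℕ} (T : Set (Set (Ed d))) (s : Set (Ed d) → ℝ) (F : Set (Ed d))
    (n : Set (Ed d) → Ed d) : Ed d :=
  ∑ᶠ (H : Set (Ed d)) (_ : IsTilingFacet T H ∧ F ⊆ H), s H • n H

/-- A canonical scaling: positive on the `(d-1)`-faces, with zero torsion around every
`(d-2)`-face. Only the values of `s` on `(d-1)`-faces matter. -/
def IsCanonicalScaling {d : ℕ} (T : Set (Set (Ed d))) (s : Set (Ed d) → ℝ) : Prop :=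
  (∀ H, IsTilingFacet T H → 0 < s H) ∧
  ∀ F, IsTilingRidge T F → ∀ e₁ e₂ : Ed d, IsTraversalFrame F e₁ e₂ →
    ∀ n : Set (Ed d) → Ed d,
      (∀ H, IsTilingFacet T H → F ⊆ H → IsTraversalNormal F e₁ e₂ H (n H)) →
      torsion T s F n = 0

/-- Two cells are adjacent when they share a `(d-1)`-face. -/
def AdjacentCells {d : ℕ} (T : Set (Set (Ed d))) (P Q : Set (Ed d)) : Prop :=
  P ∈ T ∧ Q ∈ T ∧ P ≠ Q ∧ IsTilingFacet T (P ∩ Q)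

/-- `n` is the unit normal to the common facet `P ∩ Q`, directed from `P` to `Q`. -/
def IsUnitNormalFromTo {d : ℕ} (P Q : Set (Ed d)) (n : Ed d) : Prop :=
  ‖n‖ = 1 ∧ IsNormalTo n (P ∩ Q) ∧
    ∀ y ∈ P ∩ Q, (∀ x ∈ P, ⟪n, x⟫_ℝ ≤ ⟪n, y⟫_ℝ) ∧ (∀ x ∈ Q, ⟪n, y⟫_ℝ ≤ ⟪n, x⟫_ℝ)

/-- The embedding of `E^d` into `E^{d+1}` as the hyperplane `x_{d+1} = 0`. -/
noncomputable def embedEd {d : ℕ} (x : Ed d) : Ed1 d := WithLp.toLp 2 (x, 0)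

/-- The orthogonal projection `E^{d+1} → E^d`. -/
def projEd {d : ℕ} (z : Ed1 d) : Ed d := z.fst

/-- The normal `(0, …, 0, -1)` to `E^d` in `E^{d+1}`. -/
noncomputable def baseNormal (d : ℕ) : Ed1 d := WithLp.toLp 2 (0, -1)

/-- `P'` is a lift of `P`: a convex polyhedron in `E^{d+1}` of the same dimension whose orthogonal
projection is `P`. -/
def IsLift {d : ℕ} (P : Set (Ed d)) (P' : Set (Ed1 d)) : Prop :=
  IsConvexPolyhedron P' ∧ affDim P' = affDim P ∧ projEd '' P' = P

/-- `Q'` is a lift of `Q` up to the lift `P'` of `P`: the intersection `P' ∩ Q'` is a face of both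
and projects onto `P ∩ Q`. -/
def IsLiftUpTo {d : ℕ} (P : Set (Ed d)) (P' : Set (Ed1 d)) (Q : Set (Ed d)) (Q' : Set (Ed1 d)) :
    Prop :=
  IsLift Q Q' ∧ IsExposed ℝ P' (P' ∩ Q') ∧ IsExposed ℝ Q' (P' ∩ Q') ∧
    projEd '' (P' ∩ Q') = P ∩ Q

/-- `IsChainLift T s P₀ P P' h`: there is a chain of successively adjacent cells from `P₀` to `P`
along which the successive lifting produces the lift `P'` of `P` with normal vector `h`. The lift of
`P₀` is `P₀` itself with normal `(0, …, 0, -1)`; on passing from `P` to an adjacent `Q`, the cell `Q`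
is lifted up to the lift of `P` with normal increment `s (P ∩ Q) • n`, where `n` is the unit normal
to `P ∩ Q` directed from `P` to `Q`. -/
inductive IsChainLift {d : ℕ} (T : Set (Set (Ed d))) (s : Set (Ed d) → ℝ) (P₀ : Set (Ed d)) :
    Set (Ed d) → Set (Ed1 d) → Ed1 d → Prop
  | base : IsChainLift T s P₀ P₀ (embedEd '' P₀) (baseNormal d)
  | step {P Q : Set (Ed d)} {P' Q' : Set (Ed1 d)} {h : Ed1 d} {n : Ed d} :
      IsChainLift T s P₀ P P' h → AdjacentCells T P Q → IsUnitNormalFromTo P Q n →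
      IsLiftUpTo P P' Q Q' → IsNormalTo (h + s (P ∩ Q) • embedEd n) Q' →
      IsChainLift T s P₀ Q Q' (h + s (P ∩ Q) • embedEd n)

/-- The `d`-faces of the generatrix lying over the cell `P`. -/
def generatrixFaces {d : ℕ} (T : Set (Set (Ed d))) (s : Set (Ed d) → ℝ) (P₀ P : Set (Ed d)) :
    Set (Set (Ed1 d)) :=
  {P' | ∃ h, IsChainLift T s P₀ P P' h}

/-- The generatrix as a point set in `E^{d+1}`: the union of all its `d`-faces. -/
def generatrix {d : ℕ} (T : Set (Set (Ed d))) (s : Set (Ed d) → ℝ) (P₀ : Set (Ed d)) :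
    Set (Ed1 d) :=
  {z | ∃ P, ∃ P' ∈ generatrixFaces T s P₀ P, z ∈ P'}

/-- The part of the graph of `G` over `A`. -/
def graphOver {d : ℕ} (G : Ed d → ℝ) (A : Set (Ed d)) : Set (Ed1 d) :=
  {z | z.fst ∈ A ∧ z.snd = G z.fst}

/-- The epigraph of `G`. -/
def epigraph {d : ℕ} (G : Ed d → ℝ) : Set (Ed1 d) :=
  {z | G z.fst ≤ z.snd}

open Set Filter Topology

/-!
Crossing a facet from `P` to `Q` should add `s (P ∩ Q) • n` to the gradient of `G`. Around a
`(d - 2)`-face the prescribed jumps form the torsion of `s`, which vanishes, so listing the cells by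
their angle and adding up the jumps gives gradients on all cells around the face. Hence the jumps
have a potential near every point outside the faces of codimension at least three, and local
potentials are unique up to a constant because any two cells at a point are joined by adjacent
cells at that point.

These faces lie in countably many affine subspaces of codimension at least three. The cone over
each of them with a given vertex has codimension at least two, so continuing a potential along the
rays from a generic vertex never meets the exceptional faces except for rays in a set of
codimension two, which does not separate `E^d`. The continuation therefore yields a potential for
all cells, that is, gradients and affine functions on the cells which agree on common facets.

On a generic ray every facet is crossed in the direction of its normal, and `s` is positive, so
the affine function of the cell reached is the largest at its end. Thus `G` is a maximum of
affine functions.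
-/

section General

variable {V : Type*}

lemma real_induction {τ : ℝ} {good : ℝ → Prop} (h0 : good 0)
    (hright : ∀ t, 0 ≤ t → t < τ → good t → ∀ᶠ t' in 𝓝[>] t, good t')
    (hleft : ∀ t, 0 < t → t ≤ τ → (∀ t', 0 ≤ t' → t' < t → good t') → good t) :
    ∀ t, 0 ≤ t → t ≤ τ → good t := by
  by_contra! hcon
  obtain ⟨b, hb0, hbτ, hb⟩ := hcon
  let bad := {t | 0 ≤ t ∧ t ≤ τ ∧ ¬ good t}
  have hbad : bad.Nonempty := ⟨b, hb0, hbτ, hb⟩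
  have hbdd : BddBelow bad := ⟨0, fun t ht => ht.1⟩
  have hc0 : 0 ≤ sInf bad := le_csInf hbad fun t ht => ht.1
  have hcτ : sInf bad ≤ τ := (csInf_le hbdd ⟨hb0, hbτ, hb⟩).trans hbτ
  have hbefore : ∀ t, 0 ≤ t → t < sInf bad → good t := fun t ht0 htc => by
    by_contra ht
    exact htc.not_ge (csInf_le hbdd ⟨ht0, htc.le.trans hcτ, ht⟩)
  have hgood : good (sInf bad) := by
    rcases hc0.eq_or_lt with h | h
    · rwa [← h]
    · exact hleft _ h hcτ hbefore
  have hcτ' : sInf bad < τ := hcτ.lt_of_ne fun h => by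
    have hbc : sInf bad = b := le_antisymm (csInf_le hbdd ⟨hb0, hbτ, hb⟩) (h ▸ hbτ)
    exact hb (hbc ▸ hgood)
  obtain ⟨e, he, hgoode⟩ := mem_nhdsGT_iff_exists_Ioo_subset.1 (hright _ hc0 hcτ' hgood)
  obtain ⟨t, ht, hte⟩ := exists_lt_of_csInf_lt hbad he
  rcases (csInf_le hbdd ht).eq_or_lt with h | h
  · exact ht.2.2 (h ▸ hgood)
  · exact ht.2.2 (hgoode ⟨h, hte⟩)

section Span

variable [AddCommGroup V] [Module ℝ V]

lemma sub_mem_vectorSpan {F : Set V} {x y : V} (hx : x ∈ F) (hy : y ∈ F) :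
    y - x ∈ vectorSpan ℝ F := by
  simpa using vsub_mem_vectorSpan ℝ hy hx

lemma vectorSpan_le_ker {F : Set V} {W : Type*} [AddCommGroup W] [Module ℝ W] {l : V →ₗ[ℝ] W}
    {c : W} (h : ∀ y ∈ F, l y = c) : vectorSpan ℝ F ≤ LinearMap.ker l := by
  refine Submodule.span_le.2 ?_
  rintro _ ⟨y, hy, z, hz, rfl⟩
  simp [h y hy, h z hz]

/-- The affine hull of a point `x` and an affine subspace `A`. It contains the shadow of `A` seen
from `x`. -/
def joinPoint (x : V) (A : AffineSubspace ℝ V) : AffineSubspace ℝ V :=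
  affineSpan ℝ (insert x (A : Set V))

lemma finrank_joinPoint_le (x : V) (A : AffineSubspace ℝ V) :
    Module.finrank ℝ (joinPoint x A).direction ≤ Module.finrank ℝ A.direction + 1 := by
  rw [joinPoint, direction_affineSpan]
  exact finrank_vectorSpan_insert_le A x

lemma mem_joinPoint_of_lineMap_mem {x y : V} {A : AffineSubspace ℝ V} {t : ℝ} (ht : t ≠ 0)
    (h : AffineMap.lineMap x y t ∈ A) : y ∈ joinPoint x A := by
  have hy : AffineMap.lineMap x (AffineMap.lineMap x y t) t⁻¹ = y := by
    simp [AffineMap.lineMap_apply, smul_smul, inv_mul_cancel₀ ht]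
  rw [← hy]
  exact AffineMap.lineMap_mem _ (mem_affineSpan ℝ (mem_insert _ _))
    (mem_affineSpan ℝ (mem_insert_of_mem _ h))

lemma notMem_of_mem_segment {x y z : V} {A : AffineSubspace ℝ V} (hx : x ∉ A)
    (hy : y ∉ joinPoint x A) (hz : z ∈ segment ℝ x y) : z ∉ A := by
  rw [segment_eq_image_lineMap] at hz
  obtain ⟨t, -, rfl⟩ := hz
  rcases eq_or_ne t 0 with rfl | ht
  · simpa using hx
  · exact fun h => hy (mem_joinPoint_of_lineMap_mem ht h)

end Span

lemma eventually_add_smul_mem [AddCommGroup V] [Module ℝ V] [TopologicalSpace V]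
    [ContinuousAdd V] [ContinuousSMul ℝ V] {U : Set V} {x : V} (hU : U ∈ 𝓝 x) (v : V) :
    ∀ᶠ ε in 𝓝[>] (0 : ℝ), x + ε • v ∈ U := by
  have hcont : Continuous fun ε : ℝ => x + ε • v := by fun_prop
  exact ((hcont.tendsto' 0 x (by simp)).mono_left nhdsWithin_le_nhds).eventually hU

lemma exists_mem_forall_notMem_of_isOpen [NormedAddCommGroup V] [NormedSpace ℝ V]
    [FiniteDimensional ℝ V] {U : Set V} (hU : IsOpen U) (hne : U.Nonempty)
    {𝒜 : Set (AffineSubspace ℝ V)} (h𝒜 : 𝒜.Countable) (htop : ∀ A ∈ 𝒜, A ≠ ⊤) :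
    ∃ y ∈ U, ∀ A ∈ 𝒜, y ∉ A := by
  let _ : MeasurableSpace V := borel V
  have _ : BorelSpace V := ⟨rfl⟩
  have hnull : MeasureTheory.Measure.addHaar (⋃ A ∈ 𝒜, (A : Set V)) = 0 :=
    (MeasureTheory.measure_biUnion_null_iff h𝒜).2 fun A hA =>
      MeasureTheory.Measure.addHaar_affineSubspace _ A (htop A hA)
  by_contra! h
  refine (hU.measure_pos MeasureTheory.Measure.addHaar hne).ne'
    (MeasureTheory.measure_mono_null (fun y hy => ?_) hnull)
  obtain ⟨A, hA, hyA⟩ := h y hy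
  exact mem_biUnion hA hyA

variable [NormedAddCommGroup V] [InnerProductSpace ℝ V]

lemma affDim_eq_finrank_of_interior_nonempty {F : Set V} (h : (interior F).Nonempty) :
    affDim F = Module.finrank ℝ V := by
  rw [affDim, ← direction_affineSpan, affineSpan_eq_top_of_nonempty_interior
    (h.mono (interior_mono (subset_convexHull ℝ F))), AffineSubspace.direction_top, finrank_top]

section FiniteDimensional

variable [FiniteDimensional ℝ V]

lemma affDim_mono {F H : Set V} (h : F ⊆ H) : affDim F ≤ affDim H :=
  Submodule.finrank_mono (vectorSpan_mono ℝ h)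

lemma affDim_le_finrank (F : Set V) : affDim F ≤ Module.finrank ℝ V :=
  Submodule.finrank_le (vectorSpan ℝ F)

lemma interior_nonempty_of_affDim_eq_finrank {F : Set V} (hF : Convex ℝ F) (hne : F.Nonempty)
    (h : affDim F = Module.finrank ℝ V) : (interior F).Nonempty := by
  rw [hF.interior_nonempty_iff_affineSpan_eq_top,
    ← AffineSubspace.direction_eq_top_iff_of_nonempty (hne.mono (subset_affineSpan ℝ F)),
    direction_affineSpan]
  exact Submodule.eq_top_of_finrank_eq h

lemma exists_mem_forall_notMem_of_convex {K : Set V} (hK : Convex ℝ K) (hne : K.Nonempty)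
    {𝒜 : Set (AffineSubspace ℝ V)} (h𝒜 : 𝒜.Countable)
    (hdim : ∀ A ∈ 𝒜, Module.finrank ℝ A.direction < affDim K) : ∃ y ∈ K, ∀ A ∈ 𝒜, y ∉ A := by
  obtain ⟨x, hx⟩ := hne
  let L := vectorSpan ℝ K
  let φ : L →ᵃ[ℝ] V := L.subtype.toAffineMap + AffineMap.const ℝ L x
  have hφ : ∀ v : L, φ v = (v : V) + x := fun v => rfl
  have hφlin : φ.linear = L.subtype := by ext v; simp [φ]
  have himg : φ '' (φ ⁻¹' K) = K := image_preimage_eq_of_subset fun y hy =>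
    ⟨⟨y - x, sub_mem_vectorSpan hx hy⟩, by simp [hφ]⟩
  have hmap : (vectorSpan ℝ (φ ⁻¹' K)).map L.subtype = (⊤ : Submodule ℝ L).map L.subtype := by
    rw [← hφlin, AffineMap.map_vectorSpan, himg, hφlin, Submodule.map_top, Submodule.range_subtype]
  have hint : (interior (φ ⁻¹' K)).Nonempty := by
    refine interior_nonempty_of_affDim_eq_finrank (hK.affine_preimage φ)
      ⟨0, by simpa [hφ] using hx⟩ ?_
    rw [affDim, Submodule.map_injective_of_injective L.injective_subtype hmap, finrank_top]
  obtain ⟨v, hv, hv𝒜⟩ := exists_mem_forall_notMem_of_isOpen isOpen_interior hint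
      (h𝒜.image (AffineSubspace.comap φ)) <| by
    rintro _ ⟨A, hA, rfl⟩ htop
    have hmem : ∀ v : L, φ v ∈ A := fun v => by
      rw [← AffineSubspace.mem_comap, htop]; exact AffineSubspace.mem_top ℝ L v
    refine (hdim A hA).not_ge (Submodule.finrank_mono fun v hv => ?_)
    simpa [hφ] using AffineSubspace.vsub_mem_direction (hmem ⟨v, hv⟩) (hmem 0)
  exact ⟨φ v, (interior_subset hv : v ∈ φ ⁻¹' K), fun A hA => hv𝒜 _ (mem_image_of_mem _ hA)⟩

lemma isPreconnected_setOf_forall_notMem {K : Set V} (hK : Convex ℝ K)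
    {𝒜 : Set (AffineSubspace ℝ V)} (h𝒜 : 𝒜.Countable)
    (hdim : ∀ A ∈ 𝒜, Module.finrank ℝ A.direction + 2 ≤ affDim K) :
    IsPreconnected {y ∈ K | ∀ A ∈ 𝒜, y ∉ A} := by
  refine isPreconnected_of_forall_pair fun y hy z hz => ?_
  obtain ⟨w, hwK, hw⟩ := exists_mem_forall_notMem_of_convex hK ⟨y, hy.1⟩
      ((h𝒜.image (joinPoint y)).union (h𝒜.image (joinPoint z))) <| by
    rintro _ (⟨A, hA, rfl⟩ | ⟨A, hA, rfl⟩) <;>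
      exact (finrank_joinPoint_le _ A).trans_lt (hdim A hA)
  have hsub : ∀ p ∈ {y ∈ K | ∀ A ∈ 𝒜, y ∉ A}, (∀ A ∈ 𝒜, w ∉ joinPoint p A) →
      segment ℝ p w ⊆ {y ∈ K | ∀ A ∈ 𝒜, y ∉ A} := fun p hp hpw q hq =>
    ⟨hK.segment_subset hp.1 hwK hq, fun A hA => notMem_of_mem_segment (hp.2 A hA) (hpw A hA) hq⟩
  refine ⟨segment ℝ y w ∪ segment ℝ z w, union_subset ?_ ?_, ?_, ?_, ?_⟩
  · exact hsub y hy fun A hA => hw _ (Or.inl (mem_image_of_mem _ hA))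
  · exact hsub z hz fun A hA => hw _ (Or.inr (mem_image_of_mem _ hA))
  · exact Or.inl (left_mem_segment ℝ y w)
  · exact Or.inr (left_mem_segment ℝ z w)
  · exact (convex_segment y w).isPreconnected.union w (right_mem_segment ℝ y w)
      (right_mem_segment ℝ z w) (convex_segment z w).isPreconnected

lemma eq_or_eq_neg_of_unit_normals {L : Submodule ℝ V}
    (hL : Module.finrank ℝ V ≤ Module.finrank ℝ L + 1) {n m : V} (hn : ‖n‖ = 1) (hm : ‖m‖ = 1)
    (hnL : ∀ v ∈ L, ⟪n, v⟫_ℝ = 0) (hmL : ∀ v ∈ L, ⟪m, v⟫_ℝ = 0) : m = n ∨ m = -n := by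
  have hnL' : n ∈ Lᗮ := (Submodule.mem_orthogonal' L n).2 hnL
  have hmL' : m ∈ Lᗮ := (Submodule.mem_orthogonal' L m).2 hmL
  have hn0 : (⟨n, hnL'⟩ : Lᗮ) ≠ 0 := fun h => by
    simp [show n = 0 from congrArg Subtype.val h] at hn
  have hadd := Submodule.finrank_add_finrank_orthogonal L
  have hpos : 0 < Module.finrank ℝ Lᗮ := Module.finrank_pos_iff_exists_ne_zero.2 ⟨_, hn0⟩
  obtain ⟨c, hc⟩ := exists_smul_eq_of_finrank_eq_one (K := ℝ) (by omega) hn0 ⟨m, hmL'⟩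
  have hcm : c • n = m := congrArg Subtype.val hc
  have hc1 : |c| = 1 := by
    simpa [norm_smul, hn, hm] using congrArg norm hcm
  rcases (abs_eq zero_le_one).1 hc1 with h | h
  · left; rw [← hcm, h, one_smul]
  · right; rw [← hcm, h, neg_one_smul]

end FiniteDimensional

lemma exists_mem_interior_inner_ne {P : Set V} (hP : (interior P).Nonempty) {n : V} (hn : n ≠ 0)
    (c : ℝ) : ∃ y ∈ interior P, ⟪n, y⟫_ℝ ≠ c := by
  by_contra! h
  obtain ⟨x, hx⟩ := hP
  obtain ⟨ε, hε, hε0⟩ := ((eventually_add_smul_mem (isOpen_interior.mem_nhds hx) n).and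
    self_mem_nhdsWithin).exists
  have hinner := h _ hε
  rw [inner_add_right, h x hx, inner_smul_right, real_inner_self_eq_norm_sq] at hinner
  have hpos : 0 < ε * ‖n‖ ^ 2 := mul_pos hε0 (by positivity)
  linarith

end General

section Feasible

variable {V : Type*} [AddCommGroup V] [Module ℝ V]

/-- The directions in which one can leave `x` staying in `P`: the infinitesimal cone of `P` at `x`,
which describes `P` near `x`. -/
def feasible (P : Set V) (x : V) : Set V :=
  {v | ∀ᶠ ε in 𝓝[>] (0 : ℝ), x + ε • v ∈ P}

variable {P Q : Set V} {x y v w : V}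

lemma mem_feasible : v ∈ feasible P x ↔ ∀ᶠ ε in 𝓝[>] (0 : ℝ), x + ε • v ∈ P := Iff.rfl

lemma feasible_mono (h : P ⊆ Q) (x : V) : feasible P x ⊆ feasible Q x :=
  fun _ hv => (mem_feasible.1 hv).mono fun _ hε => h hε

lemma zero_mem_feasible (hx : x ∈ P) : 0 ∈ feasible P x :=
  mem_feasible.2 (Eventually.of_forall fun ε => by simpa using hx)

lemma smul_mem_feasible (hv : v ∈ feasible P x) {c : ℝ} (hc : 0 < c) : c • v ∈ feasible P x := by
  have hlim : Tendsto (fun ε : ℝ => ε * c) (𝓝[>] 0) (𝓝[>] 0) := by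
    refine tendsto_nhdsWithin_iff.2 ⟨?_, ?_⟩
    · exact ((continuous_mul_const c).tendsto' 0 0 (zero_mul c)).mono_left nhdsWithin_le_nhds
    · filter_upwards [self_mem_nhdsWithin] with ε hε using mul_pos hε hc
  filter_upwards [hlim.eventually (mem_feasible.1 hv)] with ε hε
  simpa only [smul_smul] using hε

lemma add_mem_feasible (hP : Convex ℝ P) (hv : v ∈ feasible P x) (hw : w ∈ feasible P x) :
    v + w ∈ feasible P x := by
  rw [mem_feasible]
  filter_upwards [smul_mem_feasible hv two_pos, smul_mem_feasible hw two_pos] with ε hv hw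
  convert hP hv hw (a := 1 / 2) (b := 1 / 2) (by norm_num) (by norm_num) (by norm_num) using 1
  module

lemma sub_mem_feasible (hP : Convex ℝ P) (hx : x ∈ P) (hy : y ∈ P) : y - x ∈ feasible P x := by
  filter_upwards [Ioc_mem_nhdsGT zero_lt_one] with ε hε
  exact hP.add_smul_sub_mem hx hy ⟨hε.1.le, hε.2⟩

lemma mem_feasible_of_mem_vectorSpan (hP : Convex ℝ P) (hx : x ∈ P)
    (hneg : ∀ y ∈ P, x - y ∈ feasible P x) (hv : v ∈ vectorSpan ℝ P) : v ∈ feasible P x := by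
  suffices h : v ∈ feasible P x ∧ -v ∈ feasible P x from h.1
  rw [vectorSpan_eq_span_vsub_set_right ℝ hx] at hv
  induction hv using Submodule.span_induction with
  | mem v hv =>
    obtain ⟨y, hy, rfl⟩ := hv
    exact ⟨sub_mem_feasible hP hx hy, by simpa using hneg y hy⟩
  | zero => simpa using zero_mem_feasible hx
  | add v w _ _ hv hw =>
    exact ⟨add_mem_feasible hP hv.1 hw.1, by
      simpa only [neg_add] using add_mem_feasible hP hv.2 hw.2⟩
  | smul c v _ hv =>
    rcases lt_trichotomy c 0 with hc | rfl | hc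
    · have hc' : 0 < -c := neg_pos.2 hc
      exact ⟨by simpa using smul_mem_feasible hv.2 hc', by simpa using smul_mem_feasible hv.1 hc'⟩
    · simpa using zero_mem_feasible hx
    · exact ⟨smul_mem_feasible hv.1 hc, by simpa using smul_mem_feasible hv.2 hc⟩

lemma mem_of_isExtreme_of_sub_mem_feasible (h : IsExtreme ℝ P Q) (hx : x ∈ Q) (hy : y ∈ P)
    (hfeas : x - y ∈ feasible P x) : y ∈ Q := by
  obtain ⟨ε, hε, hε0⟩ := ((mem_feasible.1 hfeas).and self_mem_nhdsWithin).exists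
  replace hε0 : 0 < ε := hε0
  refine h.left_mem_of_mem_openSegment hy hε hx
    ⟨ε / (1 + ε), 1 / (1 + ε), by positivity, by positivity, by field_simp; ring, ?_⟩
  match_scalars <;> field_simp
  ring

section Topology

variable [TopologicalSpace V]

lemma mem_feasible_of_mem_nhds [ContinuousAdd V] [ContinuousSMul ℝ V] (h : P ∈ 𝓝 x) (v : V) :
    v ∈ feasible P x :=
  eventually_add_smul_mem h v

lemma subset_of_isExtreme_of_mem_interior [ContinuousAdd V] [ContinuousSMul ℝ V]
    (h : IsExtreme ℝ P Q) (hx : x ∈ Q) (hxP : x ∈ interior P) : P ⊆ Q := fun _ hy =>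
  mem_of_isExtreme_of_sub_mem_feasible h hx hy
    (mem_feasible_of_mem_nhds (mem_interior_iff_mem_nhds.1 hxP) _)

lemma exists_functional_of_isExposed (h : IsExposed ℝ P Q) (hx : x ∈ Q) :
    ∃ l : V →L[ℝ] ℝ, (∀ y ∈ P, l y ≤ l x) ∧ (∀ y ∈ P, l y = l x → y ∈ Q) ∧
      ∀ v ∈ vectorSpan ℝ Q, l v = 0 := by
  obtain ⟨l, rfl⟩ := h ⟨x, hx⟩
  refine ⟨l, hx.2, fun y hy hyx => ⟨hy, hyx ▸ hx.2⟩, fun v hv => ?_⟩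
  exact vectorSpan_le_ker (l := (l : V →ₗ[ℝ] ℝ)) (c := l x)
    (fun y hy => le_antisymm (hx.2 y hy.1) (hy.2 x hx.1)) hv

lemma subset_of_isExposed_of_vectorSpan_le (h : IsExposed ℝ P Q) {S : Set V} (hS : S ⊆ P)
    (hxQ : x ∈ Q) (hxS : x ∈ S) (hspan : vectorSpan ℝ S ≤ vectorSpan ℝ Q) : S ⊆ Q := by
  obtain ⟨l, -, hmem, hker⟩ := exists_functional_of_isExposed h hxQ
  refine fun y hy => hmem y (hS hy) ?_
  rw [← sub_eq_zero, ← map_sub, hker _ (hspan (sub_mem_vectorSpan hxS hy))]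

end Topology

end Feasible

section Stars

variable {d : ℕ} {T : Set (Set (Ed d))} {P Q : Set (Ed d)} {x y z : Ed d} {k : ℕ}

/-- The cells containing the point `x`. -/
def cellsAt (T : Set (Set (Ed d))) (x : Ed d) : Set (Set (Ed d)) := {P | P ∈ T ∧ x ∈ P}

/-- The intersection of all cells containing `x`, which is the smallest face of the tiling
containing `x`. -/
def core (T : Set (Set (Ed d))) (x : Ed d) : Set (Ed d) := ⋂₀ cellsAt T x

/-- The affine hulls of the intersections of cells of codimension at least `k`. A point outside all
of them has a core of codimension less than `k`. -/
def skel (T : Set (Set (Ed d))) (k : ℕ) : Set (AffineSubspace ℝ (Ed d)) :=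
  (fun S : Set (Set (Ed d)) => affineSpan ℝ (⋂₀ S)) ''
    {S | (S.Finite ∧ S ⊆ T) ∧ affDim (⋂₀ S) + k ≤ d}

lemma mem_core (T : Set (Set (Ed d))) (x : Ed d) : x ∈ core T x := fun _ hP => hP.2

lemma core_subset (hP : P ∈ cellsAt T x) : core T x ⊆ P := sInter_subset_of_mem hP

lemma finrank_direction_of_mem_skel {A : AffineSubspace ℝ (Ed d)} (hA : A ∈ skel T k) :
    Module.finrank ℝ A.direction + k ≤ d := by
  obtain ⟨S, ⟨-, hS⟩, rfl⟩ := hA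
  rwa [direction_affineSpan]

namespace IsNormalTiling

lemma isClosed (hT : IsNormalTiling T) (hP : P ∈ T) : IsClosed P := by
  obtain ⟨A, rfl⟩ := hT.polyhedron P hP
  simp only [ofPred_forall]
  exact isClosed_biInter fun a _ => isClosed_le (by fun_prop) continuous_const

lemma convex (hT : IsNormalTiling T) (hP : P ∈ T) : Convex ℝ P := by
  obtain ⟨A, rfl⟩ := hT.polyhedron P hP
  simp only [ofPred_forall]
  exact convex_iInter₂ fun a _ => convex_halfSpace_le (innerₛₗ ℝ a.1).isLinear _

lemma closure_interior (hT : IsNormalTiling T) (hP : P ∈ T) : closure (interior P) = P := by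
  rw [(hT.convex hP).closure_interior_eq_closure_of_nonempty_interior (hT.fullDim P hP),
    (hT.isClosed hP).closure_eq]

lemma cellsAt_nonempty (hT : IsNormalTiling T) (x : Ed d) : (cellsAt T x).Nonempty := by
  obtain ⟨P, hP, hx⟩ : x ∈ ⋃₀ T := hT.cover ▸ mem_univ x
  exact ⟨P, hP, hx⟩

lemma cellsAt_finite (hT : IsNormalTiling T) (x : Ed d) : (cellsAt T x).Finite :=
  ((hT.locallyFinite.point_finite x).image Subtype.val).subset
    fun P hP => ⟨⟨P, hP.1⟩, hP.2, rfl⟩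

lemma eventually_cellsAt_subset (hT : IsNormalTiling T) (x : Ed d) :
    ∀ᶠ y in 𝓝 x, cellsAt T y ⊆ cellsAt T x := by
  filter_upwards [hT.locallyFinite.eventually_subset (fun i => hT.isClosed i.2) x] with y hy P hP
  exact ⟨hP.1, @hy ⟨P, hP.1⟩ hP.2⟩

lemma countable (hT : IsNormalTiling T) : T.Countable :=
  Set.countable_coe_iff.1 <| Set.countable_univ_iff.1 <|
    hT.locallyFinite.countable_univ fun P => (hT.fullDim P.1 P.2).mono interior_subset

lemma countable_skel (hT : IsNormalTiling T) (k : ℕ) : (skel T k).Countable :=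
  ((Set.countable_ofPred_finite_subset hT.countable).mono fun _ h => h.1).image _

lemma lt_affDim_core (hT : IsNormalTiling T) (hx : ∀ A ∈ skel T k, x ∉ A) :
    d < affDim (core T x) + k := by
  by_contra! h
  exact hx _ ⟨cellsAt T x, ⟨⟨hT.cellsAt_finite x, fun P hP => hP.1⟩, h⟩, rfl⟩
    (mem_affineSpan ℝ (mem_core T x))

lemma convex_core (hT : IsNormalTiling T) (x : Ed d) : Convex ℝ (core T x) :=
  convex_sInter fun _ hP => hT.convex hP.1

lemma eq_of_mem_interior (hT : IsNormalTiling T) (hP : P ∈ T) (hQ : Q ∈ T)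
    (hxP : x ∈ interior P) (hxQ : x ∈ Q) : P = Q := by
  by_contra hne
  rw [← hT.closure_interior hQ] at hxQ
  obtain ⟨y, hyP, hyQ⟩ := mem_closure_iff.1 hxQ _ isOpen_interior hxP
  exact Set.disjoint_left.1 (hT.disjoint P hP Q hQ hne) hyP hyQ

lemma mem_interior_of_cellsAt (hT : IsNormalTiling T) (h : ∀ Q ∈ cellsAt T x, Q = P) :
    x ∈ interior P := by
  rw [mem_interior_iff_mem_nhds]
  filter_upwards [hT.eventually_cellsAt_subset x] with y hy
  obtain ⟨Q, hQ⟩ := hT.cellsAt_nonempty y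
  exact h Q (hy hQ) ▸ hQ.2

lemma affDim_inter_lt (hT : IsNormalTiling T) (hP : P ∈ T) (hQ : Q ∈ T) (hne : P ≠ Q)
    (hPQ : (P ∩ Q).Nonempty) : affDim (P ∩ Q) < d := by
  refine lt_of_le_of_ne ((affDim_le_finrank _).trans_eq finrank_euclideanSpace_fin) fun h => ?_
  obtain ⟨x, hx⟩ := interior_nonempty_of_affDim_eq_finrank ((hT.convex hP).inter (hT.convex hQ))
    hPQ (h.trans finrank_euclideanSpace_fin.symm)
  rw [interior_inter] at hx
  exact Set.disjoint_left.1 (hT.disjoint P hP Q hQ hne) hx.1 hx.2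

lemma cellsAt_subset_of_mem_openSegment (hT : IsNormalTiling T) (hP : P ∈ T) (hy : y ∈ P)
    (hz : z ∈ P) (hx : x ∈ openSegment ℝ y z) : cellsAt T x ⊆ cellsAt T y := fun Q hQ =>
  have hxP : x ∈ P := (hT.convex hP).segment_subset hy hz (openSegment_subset_segment ℝ y z hx)
  ⟨hQ.1, ((hT.faceToFace P hP Q hQ.1).1.isExtreme.left_mem_of_mem_openSegment hy hz
    ⟨hxP, hQ.2⟩ hx).2⟩

lemma sub_mem_feasible_core (hT : IsNormalTiling T) (hy : y ∈ core T x) :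
    x - y ∈ feasible (core T x) x := by
  rw [mem_feasible]
  filter_upwards [eventually_add_smul_mem (hT.eventually_cellsAt_subset x) (x - y),
    self_mem_nhdsWithin] with ε hε hε0
  replace hε0 : 0 < ε := hε0
  obtain ⟨Q, hQ⟩ := hT.cellsAt_nonempty (x + ε • (x - y))
  have hx : x ∈ openSegment ℝ (x + ε • (x - y)) y := by
    refine ⟨1 / (1 + ε), ε / (1 + ε), by positivity, by positivity, by field_simp, ?_⟩
    match_scalars <;> field_simp
    ring
  exact fun P hP => (hT.cellsAt_subset_of_mem_openSegment hQ.1 hQ.2 (hy Q (hε hQ)) hx hP).2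

lemma mem_feasible_core (hT : IsNormalTiling T) {v : Ed d} (hv : v ∈ vectorSpan ℝ (core T x)) :
    v ∈ feasible (core T x) x :=
  mem_feasible_of_mem_vectorSpan (hT.convex_core x) (mem_core T x)
    (fun _ hy => hT.sub_mem_feasible_core hy) hv

lemma isExposed_core (hT : IsNormalTiling T) (hP : P ∈ cellsAt T x) :
    IsExposed ℝ P (core T x) := by
  classical
  have hcore : core T x = ⋂₀ (((hT.cellsAt_finite x).toFinset.image (P ∩ ·) :
      Finset (Set (Ed d))) : Set (Set (Ed d))) := by
    ext y
    simp only [core, mem_sInter, Finset.coe_image, Finite.coe_toFinset, mem_image,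
      forall_exists_index, and_imp, forall_apply_eq_imp_iff₂, mem_inter_iff]
    exact ⟨fun h Q hQ => ⟨h P hP, h Q hQ⟩, fun h Q hQ => (h Q hQ).2⟩
  rw [hcore]
  refine IsExposed.sInter (Finset.Nonempty.image ⟨P, by simpa using hP⟩ _) fun B hB => ?_
  obtain ⟨Q, hQ, rfl⟩ := Finset.mem_image.1 hB
  exact (hT.faceToFace P hP.1 Q ((hT.cellsAt_finite x).mem_toFinset.1 hQ).1).1

lemma core_subset_of_isExtreme (hT : IsNormalTiling T) (hP : P ∈ cellsAt T x)
    (h : IsExtreme ℝ P Q) (hx : x ∈ Q) : core T x ⊆ Q := fun _ hy =>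
  mem_of_isExtreme_of_sub_mem_feasible h hx (core_subset hP hy)
    (feasible_mono (core_subset hP) x (hT.sub_mem_feasible_core hy))

end IsNormalTiling

end Stars

section Adjacency

variable {d : ℕ} {T : Set (Set (Ed d))} {P Q R : Set (Ed d)} {x z n m : Ed d}

namespace AdjacentCells

lemma symm (h : AdjacentCells T P Q) : AdjacentCells T Q P :=
  ⟨h.2.1, h.1, h.2.2.1.symm, by rw [inter_comm]; exact h.2.2.2⟩

lemma nonempty (h : AdjacentCells T P Q) : (P ∩ Q).Nonempty := h.2.2.2.1.1

lemma affDim (h : AdjacentCells T P Q) : affDim (P ∩ Q) + 1 = d := h.2.2.2.2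

end AdjacentCells

namespace IsUnitNormalFromTo

lemma ne_zero (h : IsUnitNormalFromTo P Q n) : n ≠ 0 := h.2.1.1

lemma symm (h : IsUnitNormalFromTo P Q n) : IsUnitNormalFromTo Q P (-n) := by
  obtain ⟨hnorm, ⟨hn, horth⟩, hside⟩ := h
  rw [IsUnitNormalFromTo, inter_comm]
  refine ⟨by simpa, ⟨by simpa, fun v hv => by simp [horth v hv]⟩, fun y hy => ⟨?_, ?_⟩⟩
  · simpa only [inner_neg_left, neg_le_neg_iff] using (hside y hy).2
  · simpa only [inner_neg_left, neg_le_neg_iff] using (hside y hy).1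

end IsUnitNormalFromTo

namespace IsNormalTiling

lemma adjacent_of_codim_le_one (hT : IsNormalTiling T) (hx : d ≤ affDim (core T x) + 1)
    (hP : P ∈ cellsAt T x) (hQ : Q ∈ cellsAt T x) (hne : P ≠ Q) : AdjacentCells T P Q := by
  have hPQ : (P ∩ Q).Nonempty := ⟨x, hP.2, hQ.2⟩
  have hlt := hT.affDim_inter_lt hP.1 hQ.1 hne hPQ
  have hle : affDim (core T x) ≤ affDim (P ∩ Q) :=
    affDim_mono (subset_inter (core_subset hP) (core_subset hQ))
  exact ⟨hP.1, hQ.1, hne, ⟨hPQ, P, hP.1, (hT.faceToFace P hP.1 Q hQ.1).1⟩, by omega⟩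

lemma exists_mem_inter_forall_notMem (hT : IsNormalTiling T) (h : AdjacentCells T P Q)
    {𝒜 : Set (AffineSubspace ℝ (Ed d))} (h𝒜 : 𝒜.Countable)
    (hdim : ∀ A ∈ 𝒜, Module.finrank ℝ A.direction + 2 ≤ d) : ∃ y ∈ P ∩ Q, ∀ A ∈ 𝒜, y ∉ A := by
  refine exists_mem_forall_notMem_of_convex ((hT.convex h.1).inter (hT.convex h.2.1)) h.nonempty
    h𝒜 fun A hA => ?_
  linarith [hdim A hA, h.affDim]

lemma exists_unitNormal (hT : IsNormalTiling T) (hP : P ∈ T) (hQ : Q ∈ T) (hne : P ≠ Q) :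
    ∃ n, IsUnitNormalFromTo P Q n := by
  have hdisj : Disjoint (interior P) Q := Set.disjoint_left.2 fun x hxP hxQ =>
    hne (hT.eq_of_mem_interior hP hQ hxP hxQ)
  obtain ⟨l, u, hl, hlP, hlQ⟩ := geometric_hahn_banach_of_nonempty_interior (hT.convex hP)
    (hT.convex hQ) hdisj (hT.fullDim P hP) ((hT.fullDim Q hQ).mono interior_subset)
  have hlu : ∀ y ∈ P ∩ Q, l y = u := fun y hy => le_antisymm (hlP y hy.1) (hlQ y hy.2)
  let m := (InnerProductSpace.toDual ℝ (Ed d)).symm l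
  have hm : ∀ v, ⟪m, v⟫_ℝ = l v := fun v => InnerProductSpace.toDual_symm_apply
  have hm0 : m ≠ 0 := by simpa [m] using hl
  have hpos : 0 < ‖m‖⁻¹ := inv_pos.2 (norm_pos_iff.2 hm0)
  refine ⟨‖m‖⁻¹ • m, norm_smul_inv_norm hm0, ⟨smul_ne_zero hpos.ne' hm0, fun v hv => ?_⟩,
    fun y hy => ⟨fun x hx => ?_, fun x hx => ?_⟩⟩
  · have hv0 : l v = 0 := vectorSpan_le_ker (l := (l : Ed d →ₗ[ℝ] ℝ)) hlu hv
    rw [real_inner_smul_left, hm, hv0, mul_zero]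
  · simpa only [real_inner_smul_left, hm, hlu y hy] using
      mul_le_mul_of_nonneg_left (hlP x hx) hpos.le
  · simpa only [real_inner_smul_left, hm, hlu y hy] using
      mul_le_mul_of_nonneg_left (hlQ x hx) hpos.le

lemma not_both_sides (hT : IsNormalTiling T) (hP : P ∈ T) (hn : n ≠ 0)
    (hle : ∀ y ∈ P, ⟪n, y⟫_ℝ ≤ ⟪n, x⟫_ℝ) (hge : ∀ y ∈ P, ⟪n, x⟫_ℝ ≤ ⟪n, y⟫_ℝ) : False := by
  obtain ⟨y, hy, hne⟩ := exists_mem_interior_inner_ne (hT.fullDim P hP) hn ⟪n, x⟫_ℝ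
  exact hne (le_antisymm (hle y (interior_subset hy)) (hge y (interior_subset hy)))

lemma unitNormal_unique (hT : IsNormalTiling T) (h : AdjacentCells T P Q)
    (hn : IsUnitNormalFromTo P Q n) (hm : IsUnitNormalFromTo P Q m) : m = n := by
  obtain ⟨x, hx⟩ := h.nonempty
  refine (eq_or_eq_neg_of_unit_normals (finrank_euclideanSpace_fin.trans_le h.affDim.ge)
    hn.1 hm.1 hn.2.1.2 hm.2.1.2).resolve_right ?_
  rintro rfl
  exact hT.not_both_sides h.1 hn.ne_zero (hn.2.2 x hx).1 fun y hy => by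
    simpa using (hm.2.2 x hx).1 y hy

lemma eq_or_eq_of_codim_le_one (hT : IsNormalTiling T) (hx : d ≤ affDim (core T x) + 1)
    (hP : P ∈ cellsAt T x) (hQ : Q ∈ cellsAt T x) (hR : R ∈ cellsAt T x) (hne : P ≠ Q) :
    R = P ∨ R = Q := by
  by_contra! hRPQ
  obtain ⟨n, hn⟩ := hT.exists_unitNormal hP.1 hQ.1 hne
  obtain ⟨m, hm⟩ := hT.exists_unitNormal hP.1 hR.1 hRPQ.1.symm
  obtain ⟨k, hk⟩ := hT.exists_unitNormal hQ.1 hR.1 hRPQ.2.symm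
  have horth : ∀ {R S : Set (Ed d)} {n : Ed d}, R ∈ cellsAt T x → S ∈ cellsAt T x →
      IsUnitNormalFromTo R S n → ∀ v ∈ vectorSpan ℝ (core T x), ⟪n, v⟫_ℝ = 0 :=
    fun hR hS hn v hv =>
      hn.2.1.2 v (vectorSpan_mono ℝ (subset_inter (core_subset hR) (core_subset hS)) hv)
  have eq_or_eq_neg := @eq_or_eq_neg_of_unit_normals _ _ _ _ (vectorSpan ℝ (core T x))
    (finrank_euclideanSpace_fin.trans_le hx)
  have hnx := hn.2.2 x ⟨hP.2, hQ.2⟩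
  have hmx := hm.2.2 x ⟨hP.2, hR.2⟩
  have hkx := hk.2.2 x ⟨hQ.2, hR.2⟩
  rcases eq_or_eq_neg hn.1 hm.1 (horth hP hQ hn) (horth hP hR hm) with rfl | rfl
  · rcases eq_or_eq_neg hn.1 hk.1 (horth hP hQ hn) (horth hQ hR hk) with rfl | rfl
    · exact hT.not_both_sides hQ.1 hn.ne_zero hkx.1 hnx.2
    · exact hT.not_both_sides hR.1 hn.ne_zero (fun y hy => by simpa using hkx.2 y hy) hmx.2
  · exact hT.not_both_sides hP.1 hn.ne_zero hnx.1 fun y hy => by simpa using hmx.1 y hy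

lemma eventually_mem_interior (hT : IsNormalTiling T) (hn : IsUnitNormalFromTo P Q n)
    (hz : z ∈ P ∩ Q) (hcells : ∀ R ∈ cellsAt T z, R = P ∨ R = Q) :
    ∀ᶠ y in 𝓝 z, ⟪n, y⟫_ℝ < ⟪n, z⟫_ℝ → y ∈ interior P := by
  filter_upwards [hT.eventually_cellsAt_subset z] with y hy hyn
  refine hT.mem_interior_of_cellsAt fun R hR => (hcells R (hy hR)).resolve_right ?_
  rintro rfl
  exact hyn.not_ge ((hn.2.2 z hz).2 y hR.2)

end IsNormalTiling

end Adjacency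

section CellInduction

variable {d : ℕ} {T : Set (Set (Ed d))} {P Q : Set (Ed d)} {x : Ed d} {Φ : Set (Ed d) → Prop}

namespace IsNormalTiling

lemma cell_induction (hT : IsNormalTiling T) {γ : ℝ → Ed d} (hγ : Continuous γ) {τ : ℝ}
    (h0 : ∀ P ∈ cellsAt T (γ 0), Φ P)
    (hstep : ∀ t, 0 < t → t ≤ τ → ∀ Q ∈ cellsAt T (γ t), ∀ R ∈ cellsAt T (γ t),
      (∃ t', 0 ≤ t' ∧ t' < t ∧ γ t' ∈ Q) → Φ Q → Φ R) :
    ∀ t, 0 ≤ t → t ≤ τ → ∀ P ∈ cellsAt T (γ t), Φ P := by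
  have hev : ∀ t, ∀ᶠ t' in 𝓝 t, cellsAt T (γ t') ⊆ cellsAt T (γ t) := fun t =>
    (hγ.tendsto t).eventually (hT.eventually_cellsAt_subset (γ t))
  refine real_induction (good := fun t => ∀ P ∈ cellsAt T (γ t), Φ P) h0 ?_ ?_
  · intro t _ _ ht
    filter_upwards [(hev t).filter_mono nhdsWithin_le_nhds] with t' ht' P hP using ht P (ht' hP)
  · intro t ht htτ hbefore R hR
    obtain ⟨t', ht', ht'0, ht't⟩ :=
      (((hev t).filter_mono (nhdsWithin_le_nhds (s := Iio t))).and (Ioo_mem_nhdsLT ht)).exists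
    obtain ⟨Q, hQ⟩ := hT.cellsAt_nonempty (γ t')
    exact hstep t ht htτ Q (ht' hQ) R hR ⟨t', ht'0.le, ht't, hQ.2⟩ (hbefore t' ht'0.le ht't Q hQ)

lemma interior_inter_nonempty (hT : IsNormalTiling T) (hP : P ∈ T) {U : Set (Ed d)}
    (hU : IsOpen U) (hPU : (P ∩ U).Nonempty) : (interior P ∩ U).Nonempty := by
  obtain ⟨x, hxP, hxU⟩ := hPU
  rw [← hT.closure_interior hP] at hxP
  exact (mem_closure_iff.1 hxP U hU hxU).mono (inter_comm U _).subset

lemma cell_induction_of_isOpen (hT : IsNormalTiling T) {U : Set (Ed d)} (hU : IsOpen U)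
    (hUc : Convex ℝ U) (hP : P ∈ T) (hQ : Q ∈ T) (hPU : (P ∩ U).Nonempty)
    (hQU : (Q ∩ U).Nonempty) (hΦ : Φ P)
    (hstep : ∀ u ∈ U, ∀ R ∈ cellsAt T u, ∀ S ∈ cellsAt T u, AdjacentCells T R S → Φ R → Φ S) :
    Φ Q := by
  obtain ⟨y, hyP, hyU⟩ := hT.interior_inter_nonempty hP hU hPU
  obtain ⟨z, ⟨hzQ, hzU⟩, hz⟩ := exists_mem_forall_notMem_of_isOpen (isOpen_interior.inter hU)
      (hT.interior_inter_nonempty hQ hU hQU) ((hT.countable_skel 2).image (joinPoint y)) <| by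
    rintro _ ⟨A, hA, rfl⟩ htop
    have hjoin := finrank_joinPoint_le y A
    rw [htop, AffineSubspace.direction_top, finrank_top, finrank_euclideanSpace_fin] at hjoin
    have hA := finrank_direction_of_mem_skel hA
    omega
  refine hT.cell_induction (γ := AffineMap.lineMap y z) (τ := 1) AffineMap.lineMap_continuous
    (fun R hR => ?_) (fun t ht0 ht1 R hR S hS _ hΦR => ?_) 1 zero_le_one le_rfl Q
    ⟨hQ, by simpa using interior_subset hzQ⟩
  · rw [AffineMap.lineMap_apply_zero] at hR
    rwa [← hT.eq_of_mem_interior hP hR.1 hyP hR.2]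
  · rcases eq_or_ne R S with rfl | hne
    · exact hΦR
    have hcodim : d < affDim (core T (AffineMap.lineMap y z t)) + 2 :=
      hT.lt_affDim_core fun A hA hmem =>
        hz _ (mem_image_of_mem _ hA) (mem_joinPoint_of_lineMap_mem ht0.ne' hmem)
    exact hstep _ (hUc.lineMap_mem hyU hzU ⟨ht0.le, ht1⟩) R hR S hS
      (hT.adjacent_of_codim_le_one (by omega) hR hS hne) hΦR

lemma cellsAt_induction (hT : IsNormalTiling T) (hP : P ∈ cellsAt T x) (hQ : Q ∈ cellsAt T x)
    (hΦ : Φ P)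
    (hstep : ∀ R ∈ cellsAt T x, ∀ S ∈ cellsAt T x, AdjacentCells T R S → Φ R → Φ S) : Φ Q := by
  obtain ⟨r, hr, hball⟩ := Metric.eventually_nhds_iff_ball.1 (hT.eventually_cellsAt_subset x)
  exact hT.cell_induction_of_isOpen Metric.isOpen_ball (convex_ball x r) hP.1 hQ.1
    ⟨x, hP.2, Metric.mem_ball_self hr⟩ ⟨x, hQ.2, Metric.mem_ball_self hr⟩ hΦ
    fun u hu R hR S hS => hstep R (hball u hu hR) S (hball u hu hS)

end IsNormalTiling

end CellInduction

section Facets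

variable {d : ℕ} {T : Set (Set (Ed d))} {P H : Set (Ed d)} {x z : Ed d}

lemma mem_cellsAt_of_core_eq (hz : core T z = H) (hx : x ∈ H) (hP : P ∈ cellsAt T z) :
    P ∈ cellsAt T x :=
  ⟨hP.1, core_subset hP (hz ▸ hx)⟩

namespace IsNormalTiling

lemma convex_facet (hT : IsNormalTiling T) (hH : IsTilingFacet T H) : Convex ℝ H := by
  obtain ⟨⟨-, P, hP, hexp⟩, -⟩ := hH
  exact hexp.convex (hT.convex hP)

lemma notMem_interior_of_mem_facet (hT : IsNormalTiling T) (hH : IsTilingFacet T H) (hP : P ∈ T)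
    (hx : x ∈ H) : x ∉ interior P := by
  intro hxP
  obtain ⟨⟨-, R, hR, hexp⟩, hdim⟩ := hH
  obtain rfl := hT.eq_of_mem_interior hP hR hxP (hexp.subset hx)
  have hPH : P ⊆ H := subset_of_isExtreme_of_mem_interior hexp.isExtreme hx hxP
  have hdimH : affDim H = d := (affDim_eq_finrank_of_interior_nonempty
    ((hT.fullDim P hP).mono (interior_mono hPH))).trans finrank_euclideanSpace_fin
  omega

lemma core_eq_facet (hT : IsNormalTiling T) (hH : IsTilingFacet T H) (hz : z ∈ H)
    (hcodim : d ≤ affDim (core T z) + 1) : core T z = H := by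
  obtain ⟨⟨-, P, hP, hexp⟩, hdim⟩ := hH
  have hPz : P ∈ cellsAt T z := ⟨hP, hexp.subset hz⟩
  have hsub : core T z ⊆ H := hT.core_subset_of_isExtreme hPz hexp.isExtreme hz
  have hspan : vectorSpan ℝ (core T z) = vectorSpan ℝ H :=
    Submodule.eq_of_le_of_finrank_le (vectorSpan_mono ℝ hsub) (by unfold affDim at *; omega)
  exact hsub.antisymm <| subset_of_isExposed_of_vectorSpan_le (hT.isExposed_core hPz) hexp.subset
    (mem_core T z) hz hspan.ge

lemma exists_core_eq_facet (hT : IsNormalTiling T) (hH : IsTilingFacet T H) :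
    ∃ z, core T z = H := by
  obtain ⟨z, hzH, hz⟩ := exists_mem_forall_notMem_of_convex (hT.convex_facet hH) hH.1.1
    (hT.countable_skel 2) fun A hA => by
      linarith [finrank_direction_of_mem_skel hA, hH.2]
  have hcodim : d < affDim (core T z) + 2 := hT.lt_affDim_core hz
  exact ⟨z, hT.core_eq_facet hH hzH (by omega)⟩

lemma finite_facets_at (hT : IsNormalTiling T) (x : Ed d) :
    {H | IsTilingFacet T H ∧ x ∈ H}.Finite := by
  refine ((hT.cellsAt_finite x).finite_subsets.image sInter).subset ?_
  rintro H ⟨hH, hx⟩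
  obtain ⟨z, hz⟩ := hT.exists_core_eq_facet hH
  exact ⟨cellsAt T z, fun P hP => mem_cellsAt_of_core_eq hz hx hP, hz⟩

end IsNormalTiling

end Facets

section ArgSum

open Complex

variable {ι W : Type*} {J : Finset ι} {u : ι → ℂ}

lemma eventually_arg_neg_div {z c : ℂ} (h : -z / c ∈ slitPlane) :
    ∀ᶠ z' in 𝓝 z, arg (-z' / c) = arg (-z / c) + arg (z' / z) := by
  have hz : z ≠ 0 := by
    rintro rfl
    simp at h
  have hlim : Tendsto (fun z' => arg (-z / c) + arg (z' / z)) (𝓝 z) (𝓝 (arg (-z / c))) := by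
    have hcont : ContinuousAt (fun z' => arg (z' / z)) z :=
      ContinuousAt.comp (continuousAt_arg (by simp [hz])) (continuousAt_id.div_const z)
    simpa [hz] using hcont.tendsto.const_add (arg (-z / c))
  have harg : arg (-z / c) ∈ Ioo (-Real.pi) Real.pi :=
    ⟨neg_pi_lt_arg _, (arg_le_pi _).lt_of_ne (mem_slitPlane_iff_arg.1 h).1⟩
  filter_upwards [hlim.eventually (Ioo_mem_nhds harg.1 harg.2), eventually_ne_nhds hz]
    with z' hmem hz'
  rw [← (arg_mul_eq_add_arg_iff (slitPlane_ne_zero h) (div_ne_zero hz' hz)).2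
    (Ioo_subset_Ioc_self hmem)]
  congr 1
  field_simp

variable [AddCommGroup W] [Module ℝ W]

/-- The angle of `z`, measured from the ray opposite to `u i`, is discontinuous across the ray of
`u i` only, where it drops by `2π`; the superposition of these angles with weights `w i` is
normalized so as to jump by `w i` on crossing the ray of `u i` counterclockwise. -/
noncomputable def argSum (J : Finset ι) (u : ι → ℂ) (w : ι → W) (z : ℂ) : W :=
  -(2 * Real.pi)⁻¹ • ∑ i ∈ J, arg (-z / u i) • w i

variable {w : ι → W}

lemma eventually_argSum_eq (hw : ∑ i ∈ J, w i = 0) {z : ℂ}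
    (hz : ∀ i ∈ J, -z / u i ∈ slitPlane) : ∀ᶠ z' in 𝓝 z, argSum J u w z' = argSum J u w z := by
  filter_upwards [(eventually_all_finset J).2 fun i hi => eventually_arg_neg_div (hz i hi)]
    with z' hz'
  rw [argSum, argSum, Finset.sum_congr rfl fun i hi => by rw [hz' i hi, add_smul],
    Finset.sum_add_distrib, ← Finset.smul_sum, hw, smul_zero, add_zero]

lemma argSum_eq_of_isPreconnected (hw : ∑ i ∈ J, w i = 0) {D : Set ℂ} (hD : IsPreconnected D)
    (hoff : ∀ z ∈ D, ∀ i ∈ J, -z / u i ∈ slitPlane) {z z' : ℂ} (hz : z ∈ D) (hz' : z' ∈ D) :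
    argSum J u w z = argSum J u w z' :=
  hD.induction₂ (fun a b => argSum J u w a = argSum J u w b)
    (fun a ha => ((eventually_argSum_eq hw (hoff a ha)).filter_mono nhdsWithin_le_nhds).mono
      fun _ h => h.symm) (fun _ _ _ _ _ _ => Eq.trans) (fun _ _ _ _ => Eq.symm) hz hz'

lemma tendsto_one_add_mul_I (c : ℂ) :
    Tendsto (fun δ : ℝ => (1 + δ * I) * c) (𝓝[>] 0) (𝓝 c) := by
  have hcont : Continuous fun δ : ℝ => (1 + δ * I) * c := by fun_prop
  simpa using (hcont.tendsto 0).mono_left nhdsWithin_le_nhds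

lemma tendsto_one_sub_mul_I (c : ℂ) :
    Tendsto (fun δ : ℝ => (1 - δ * I) * c) (𝓝[>] 0) (𝓝 c) := by
  have hcont : Continuous fun δ : ℝ => (1 - δ * I) * c := by fun_prop
  simpa using (hcont.tendsto 0).mono_left nhdsWithin_le_nhds

lemma tendsto_arg_after {c : ℂ} (hc : c ≠ 0) :
    Tendsto (fun δ : ℝ => arg (-((1 + δ * I) * c) / c)) (𝓝[>] 0) (𝓝 (-Real.pi)) := by
  refine (tendsto_arg_nhdsWithin_im_neg_of_re_neg_of_im_zero (z := -1) (by simp) (by simp)).comp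
    (tendsto_nhdsWithin_iff.2 ⟨?_, ?_⟩)
  · simpa [mul_div_assoc, hc, neg_div] using (tendsto_one_add_mul_I 1).neg
  · filter_upwards [self_mem_nhdsWithin] with δ hδ
    simpa [neg_div, hc] using hδ

lemma tendsto_arg_before {c : ℂ} (hc : c ≠ 0) :
    Tendsto (fun δ : ℝ => arg (-((1 - δ * I) * c) / c)) (𝓝[>] 0) (𝓝 Real.pi) := by
  refine (tendsto_arg_nhdsWithin_im_nonneg_of_re_neg_of_im_zero (z := -1) (by simp)
    (by simp)).comp (tendsto_nhdsWithin_iff.2 ⟨?_, ?_⟩)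
  · simpa [mul_div_assoc, hc, neg_div] using (tendsto_one_sub_mul_I 1).neg
  · filter_upwards [self_mem_nhdsWithin] with δ hδ
    simpa [neg_div, hc] using (le_of_lt hδ : (0 : ℝ) ≤ δ)

lemma neg_div_mem_slitPlane {z c : ℂ} (hc : c ≠ 0) (h : ∀ t : ℝ, 0 ≤ t → z ≠ t • c) :
    -z / c ∈ slitPlane := by
  by_contra hmem
  simp only [mem_slitPlane_iff, not_or, not_lt, not_ne_iff] at hmem
  refine h (-(-z / c).re) (by linarith [hmem.1]) ?_
  have hreal : ((-z / c).re : ℂ) = -z / c := Complex.ext rfl (by simp [hmem.2])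
  rw [real_smul, ofReal_neg, hreal]
  field_simp

end ArgSum

section ArgSumJump

open Complex

variable {ι W : Type*} [NormedAddCommGroup W] [NormedSpace ℝ W] {J : Finset ι} {u : ι → ℂ}
  {w : ι → W}

lemma tendsto_argSum_jump {i : ι} (hi : i ∈ J) (hu : u i ≠ 0)
    (hoff : ∀ j ∈ J, j ≠ i → -u i / u j ∈ slitPlane) :
    Tendsto (fun δ : ℝ => argSum J u w ((1 + δ * I) * u i) -
      argSum J u w ((1 - δ * I) * u i)) (𝓝[>] 0) (𝓝 (w i)) := by
  classical
  have hterm : ∀ j ∈ J, Tendsto (fun δ : ℝ => (arg (-((1 + δ * I) * u i) / u j) -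
      arg (-((1 - δ * I) * u i) / u j)) • w j) (𝓝[>] 0)
      (𝓝 (if j = i then (-Real.pi - Real.pi) • w i else 0)) := by
    intro j hj
    split_ifs with hji
    · subst hji
      exact ((tendsto_arg_after hu).sub (tendsto_arg_before hu)).smul_const (w j)
    · have hcont : ContinuousAt (fun z => arg (-z / u j)) (u i) :=
        ContinuousAt.comp (f := fun z => -z / u j) (continuousAt_arg (hoff j hj hji))
          (continuousAt_neg.div_const (u j))
      simpa using ((hcont.tendsto.comp (tendsto_one_add_mul_I _)).sub
        (hcont.tendsto.comp (tendsto_one_sub_mul_I _))).smul_const (w j)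
  convert (tendsto_finsetSum J hterm).const_smul (-(2 * Real.pi)⁻¹) using 1
  · simp only [argSum, sub_smul, Finset.sum_sub_distrib, smul_sub]
  · rw [Finset.sum_ite_eq' J i, if_pos hi, smul_smul]
    have hπ := Real.pi_ne_zero
    rw [show -(2 * Real.pi)⁻¹ * (-Real.pi - Real.pi) = 1 by field_simp; ring, one_smul]

lemma argSum_sub_argSum (hw : ∑ i ∈ J, w i = 0) {i : ι} (hi : i ∈ J) (hu : u i ≠ 0)
    (hoff : ∀ j ∈ J, j ≠ i → -u i / u j ∈ slitPlane) {D E : Set ℂ} (hD : IsPreconnected D)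
    (hE : IsPreconnected E) (hDoff : ∀ z ∈ D, ∀ j ∈ J, -z / u j ∈ slitPlane)
    (hEoff : ∀ z ∈ E, ∀ j ∈ J, -z / u j ∈ slitPlane)
    (hcross : ∃ᶠ δ : ℝ in 𝓝[>] 0, (1 - δ * I) * u i ∈ D ∧ (1 + δ * I) * u i ∈ E)
    {p q : ℂ} (hp : p ∈ D) (hq : q ∈ E) : argSum J u w q - argSum J u w p = w i := by
  by_contra hne
  obtain ⟨δ, ⟨hδD, hδE⟩, hδ⟩ := (hcross.and_eventually
    ((tendsto_argSum_jump hi hu hoff).eventually_ne (Ne.symm hne))).exists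
  exact hδ (congrArg₂ _ (argSum_eq_of_isPreconnected hw hE hEoff hδE hq)
    (argSum_eq_of_isPreconnected hw hD hDoff hδD hp))

end ArgSumJump

section TraversalFrame

variable {d : ℕ} {F : Set (Ed d)} {e₁ e₂ v : Ed d} {c : ℂ}

/-- The coordinates of the projection of a vector to the plane of `e₁, e₂`, which make angles around
a `(d-2)`-face available as arguments of complex numbers. -/
noncomputable def planeCoord (e₁ e₂ : Ed d) : Ed d →ₗ[ℝ] ℂ where
  toFun v := ⟨⟪e₁, v⟫_ℝ, ⟪e₂, v⟫_ℝ⟩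
  map_add' v w := by apply Complex.ext <;> simp [inner_add_right]
  map_smul' c v := by apply Complex.ext <;> simp [inner_smul_right]

/-- The vector of the plane of `e₁, e₂` with given coordinates, a right inverse of `planeCoord` when
`e₁, e₂` is orthonormal. -/
noncomputable def planeLift (e₁ e₂ : Ed d) (c : ℂ) : Ed d := c.re • e₁ + c.im • e₂

/-- The unit vector of the plane of `e₁, e₂` obtained from the direction of `c` by a quarter turn
from `e₁` to `e₂`. -/
noncomputable def quarterTurn (e₁ e₂ : Ed d) (c : ℂ) : Ed d :=
  planeLift e₁ e₂ (Complex.I * ((‖c‖⁻¹ : ℝ) • c))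

lemma inner_planeLift (e₁ e₂ : Ed d) (c : ℂ) (v : Ed d) :
    ⟪planeLift e₁ e₂ c, v⟫_ℝ =
      c.re * (planeCoord e₁ e₂ v).re + c.im * (planeCoord e₁ e₂ v).im := by
  simp [planeLift, planeCoord, inner_add_left, real_inner_smul_left]

lemma exists_isTraversalFrame (hF : affDim F + 2 = d) :
    ∃ e₁ e₂ : Ed d, IsTraversalFrame F e₁ e₂ := by
  set L := vectorSpan ℝ F
  have hL : Module.finrank ℝ Lᗮ = 2 := by
    have hadd := Submodule.finrank_add_finrank_orthogonal L
    rw [finrank_euclideanSpace_fin] at hadd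
    have hdim : Module.finrank ℝ L + 2 = d := hF
    omega
  let b : OrthonormalBasis (Fin 2) ℝ Lᗮ := (stdOrthonormalBasis ℝ Lᗮ).reindex (finCongr hL)
  exact ⟨b 0, b 1, b.orthonormal.1 0, b.orthonormal.1 1, b.orthonormal.2 (by decide),
    fun v hv => ⟨(Submodule.mem_orthogonal' L _).1 (b 0).2 v hv,
      (Submodule.mem_orthogonal' L _).1 (b 1).2 v hv⟩⟩

namespace IsTraversalFrame

lemma planeCoord_planeLift (h : IsTraversalFrame F e₁ e₂) (c : ℂ) :
    planeCoord e₁ e₂ (planeLift e₁ e₂ c) = c := by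
  obtain ⟨h₁, h₂, h₁₂, -⟩ := h
  apply Complex.ext <;>
    simp [planeCoord, planeLift, inner_add_right, inner_smul_right, h₁, h₂, h₁₂,
      real_inner_comm e₁ e₂]

lemma norm_planeLift (h : IsTraversalFrame F e₁ e₂) (c : ℂ) : ‖planeLift e₁ e₂ c‖ = ‖c‖ := by
  rw [← sq_eq_sq₀ (norm_nonneg _) (norm_nonneg _), ← real_inner_self_eq_norm_sq, inner_planeLift,
    h.planeCoord_planeLift, ← Complex.normSq_eq_norm_sq, Complex.normSq_apply]

lemma ker_planeCoord (h : IsTraversalFrame F e₁ e₂) (hF : affDim F + 2 = d) :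
    LinearMap.ker (planeCoord e₁ e₂) = vectorSpan ℝ F := by
  have hle : vectorSpan ℝ F ≤ LinearMap.ker (planeCoord e₁ e₂) := fun v hv =>
    Complex.ext (h.2.2.2 v hv).1 (h.2.2.2 v hv).2
  have hrange : LinearMap.range (planeCoord e₁ e₂) = ⊤ :=
    LinearMap.range_eq_top.2 fun c => ⟨_, h.planeCoord_planeLift c⟩
  have hrank := (planeCoord e₁ e₂).finrank_range_add_finrank_ker
  rw [hrange, finrank_top, Complex.finrank_real_complex, finrank_euclideanSpace_fin] at hrank
  exact (Submodule.eq_of_le_of_finrank_le hle (by unfold affDim at hF; omega)).symm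

lemma norm_quarterTurn (h : IsTraversalFrame F e₁ e₂) (hc : c ≠ 0) :
    ‖quarterTurn e₁ e₂ c‖ = 1 := by
  rw [quarterTurn, h.norm_planeLift, norm_mul, Complex.norm_I, one_mul, norm_smul, norm_inv,
    norm_norm, inv_mul_cancel₀ (norm_ne_zero_iff.2 hc)]

lemma planeCoord_norm_smul_quarterTurn (h : IsTraversalFrame F e₁ e₂) (c : ℂ) :
    planeCoord e₁ e₂ (‖c‖ • quarterTurn e₁ e₂ c) = Complex.I * c := by
  rcases eq_or_ne c 0 with rfl | hc
  · simp
  · rw [map_smul, quarterTurn, h.planeCoord_planeLift, ← mul_smul_comm,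
      smul_inv_smul₀ (norm_ne_zero_iff.2 hc)]

end IsTraversalFrame

lemma inner_quarterTurn_eq_zero {t : ℝ} (hv : planeCoord e₁ e₂ v = t • c) :
    ⟪quarterTurn e₁ e₂ c, v⟫_ℝ = 0 := by
  rw [quarterTurn, inner_planeLift, hv]
  simp only [Complex.I_mul_re, Complex.I_mul_im, Complex.smul_re, Complex.smul_im, smul_eq_mul]
  ring

end TraversalFrame

section Ridge

variable {d : ℕ} {T : Set (Set (Ed d))} {P Q : Set (Ed d)} {x y z z' e₁ e₂ v : Ed d}

/-- The projection to the plane of `e₁, e₂` of the interior of a cell, seen from `x`. -/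
def sector (e₁ e₂ x : Ed d) (P : Set (Ed d)) : Set ℂ :=
  (fun y => planeCoord e₁ e₂ (y - x)) '' interior P

lemma core_subset_core (h : z ∈ core T x) : core T z ⊆ core T x :=
  sInter_subset_sInter fun P hP => ⟨hP.1, h P hP⟩

namespace IsNormalTiling

lemma mem_core_of_sub_mem_vectorSpan (hT : IsNormalTiling T) (hP : P ∈ cellsAt T x) (hy : y ∈ P)
    (h : y - x ∈ vectorSpan ℝ (core T x)) : y ∈ core T x := by
  obtain ⟨l, -, hmem, hker⟩ := exists_functional_of_isExposed (hT.isExposed_core hP) (mem_core T x)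
  exact hmem y hy (sub_eq_zero.1 ((map_sub l y x).symm.trans (hker _ h)))

lemma isTilingFace_core (hT : IsNormalTiling T) (x : Ed d) : IsTilingFace T (core T x) := by
  obtain ⟨P, hP⟩ := hT.cellsAt_nonempty x
  exact ⟨⟨x, mem_core T x⟩, P, hP.1, hT.isExposed_core hP⟩

lemma core_subset_of_isTilingFace (hT : IsNormalTiling T) (hH : IsTilingFace T Q) (hx : x ∈ Q) :
    core T x ⊆ Q := by
  obtain ⟨-, P, hP, hexp⟩ := hH
  exact hT.core_subset_of_isExtreme ⟨hP, hexp.subset hx⟩ hexp.isExtreme hx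

lemma isPreconnected_sector (hT : IsNormalTiling T) (hP : P ∈ T) (e₁ e₂ x : Ed d) :
    IsPreconnected (sector e₁ e₂ x P) := by
  have hcont : Continuous (planeCoord e₁ e₂) := LinearMap.continuous_of_finiteDimensional _
  exact (hT.convex hP).interior.isPreconnected.image _
    (hcont.comp (continuous_id.sub continuous_const)).continuousOn

end IsNormalTiling

/-- `core T x` is a `(d-2)`-face with traversal frame `e₁, e₂`, and `core T z` is a `(d-1)`-face
containing it. -/
structure IsRidgeFlag (T : Set (Set (Ed d))) (e₁ e₂ x z : Ed d) : Prop where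
  frame : IsTraversalFrame (core T x) e₁ e₂
  ridge : affDim (core T x) + 2 = d
  facet : affDim (core T z) + 1 = d
  mem : x ∈ core T z

namespace IsRidgeFlag

lemma core_subset (h : IsRidgeFlag T e₁ e₂ x z) : core T x ⊆ core T z := core_subset_core h.mem

lemma ker_planeCoord (h : IsRidgeFlag T e₁ e₂ x z) :
    LinearMap.ker (planeCoord e₁ e₂) = vectorSpan ℝ (core T x) := h.frame.ker_planeCoord h.ridge

lemma planeCoord_ne_zero (h : IsRidgeFlag T e₁ e₂ x z) (hT : IsNormalTiling T) :
    planeCoord e₁ e₂ (z - x) ≠ 0 := by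
  intro h0
  obtain ⟨P, hP⟩ := hT.cellsAt_nonempty z
  have hzx : z ∈ core T x := hT.mem_core_of_sub_mem_vectorSpan ⟨hP.1, h.mem P hP⟩ hP.2
    (h.ker_planeCoord ▸ LinearMap.mem_ker.2 h0)
  have hle := affDim_mono (core_subset_core hzx)
  linarith [h.ridge, h.facet]

lemma vectorSpan_core (h : IsRidgeFlag T e₁ e₂ x z) (hT : IsNormalTiling T) :
    vectorSpan ℝ (core T z) = vectorSpan ℝ (core T x) ⊔ (ℝ ∙ (z - x)) := by
  have hlt : vectorSpan ℝ (core T x) < vectorSpan ℝ (core T x) ⊔ (ℝ ∙ (z - x)) := by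
    rw [left_lt_sup, Submodule.span_singleton_le_iff_mem, ← h.ker_planeCoord]
    exact h.planeCoord_ne_zero hT
  have hle : vectorSpan ℝ (core T x) ⊔ (ℝ ∙ (z - x)) ≤ vectorSpan ℝ (core T z) :=
    sup_le (vectorSpan_mono ℝ h.core_subset)
      ((Submodule.span_singleton_le_iff_mem _ _).2 (sub_mem_vectorSpan h.mem (mem_core T z)))
  refine (Submodule.eq_of_le_of_finrank_le hle ?_).symm
  have hrank := Submodule.finrank_lt_finrank_of_lt hlt
  have hridge := h.ridge
  have hfacet := h.facet
  unfold affDim at hridge hfacet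
  omega

lemma exists_planeCoord_eq (h : IsRidgeFlag T e₁ e₂ x z) (hT : IsNormalTiling T)
    (hy : y ∈ core T z) :
    ∃ t : ℝ, 0 ≤ t ∧ planeCoord e₁ e₂ (y - x) = t • planeCoord e₁ e₂ (z - x) := by
  obtain ⟨P, hP⟩ := hT.cellsAt_nonempty z
  obtain ⟨l, hle, hmem, hker⟩ := exists_functional_of_isExposed
    (hT.isExposed_core ⟨hP.1, h.mem P hP⟩) (mem_core T x)
  have hyx := sub_mem_vectorSpan h.mem hy
  rw [h.vectorSpan_core hT] at hyx
  obtain ⟨v, hv, w, hw, hvw⟩ := Submodule.mem_sup.1 hyx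
  obtain ⟨t, rfl⟩ := Submodule.mem_span_singleton.1 hw
  have hz : l (z - x) < 0 := by
    refine lt_of_le_of_ne (by simpa using hle z hP.2) fun h0 => h.planeCoord_ne_zero hT ?_
    rw [← LinearMap.mem_ker, h.ker_planeCoord]
    exact sub_mem_vectorSpan (mem_core T x) (hmem z hP.2 (by simpa [sub_eq_zero] using h0))
  have hlt : t * l (z - x) = l y - l x := by
    simpa [hker v hv] using congrArg l hvw
  refine ⟨t, nonneg_of_mul_nonpos_left (hlt.trans_le (sub_nonpos.2 (hle y (hy P hP)))) hz, ?_⟩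
  rw [← hvw, map_add, map_smul, LinearMap.mem_ker.1 (h.ker_planeCoord.ge hv), zero_add]

lemma mem_feasible_core (h : IsRidgeFlag T e₁ e₂ x z) (hT : IsNormalTiling T) {t : ℝ} (ht : 0 ≤ t)
    (hv : planeCoord e₁ e₂ v = t • planeCoord e₁ e₂ (z - x)) : v ∈ feasible (core T z) x := by
  have hsub : v - t • (z - x) ∈ feasible (core T z) x := by
    refine feasible_mono h.core_subset x (hT.mem_feasible_core ?_)
    rw [← h.ker_planeCoord, LinearMap.mem_ker, map_sub, map_smul, hv, sub_self]
  rcases ht.eq_or_lt with rfl | ht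
  · simpa using hsub
  · simpa using add_mem_feasible (hT.convex_core z) hsub
      (smul_mem_feasible (sub_mem_feasible (hT.convex_core z) h.mem (mem_core T z)) ht)

lemma notMem_sector (h : IsRidgeFlag T e₁ e₂ x z) (hT : IsNormalTiling T) (hP : P ∈ cellsAt T x)
    {t : ℝ} (ht : 0 ≤ t) : t • planeCoord e₁ e₂ (z - x) ∉ sector e₁ e₂ x P := by
  rintro ⟨y, hy, hyt⟩
  obtain ⟨ε, hεz, hε⟩ :=
    ((mem_feasible.1 (h.mem_feasible_core hT ht hyt)).and (Ioc_mem_nhdsGT zero_lt_one)).exists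
  exact hT.notMem_interior_of_mem_facet ⟨hT.isTilingFace_core z, h.facet⟩ hP.1 hεz
    ((hT.convex hP.1).add_smul_sub_mem_interior hP.2 hy hε)

lemma core_subset_of_planeCoord_eq (h : IsRidgeFlag T e₁ e₂ x z) (h' : IsRidgeFlag T e₁ e₂ x z')
    (hT : IsNormalTiling T) {t : ℝ} (ht : 0 ≤ t)
    (hzz' : planeCoord e₁ e₂ (z - x) = t • planeCoord e₁ e₂ (z' - x)) :
    core T z ⊆ core T z' := by
  obtain ⟨ε, hεz', hε⟩ := ((mem_feasible.1 (h'.mem_feasible_core hT ht hzz')).and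
    (Ioo_mem_nhdsGT zero_lt_one)).exists
  obtain ⟨P, hP⟩ := hT.cellsAt_nonempty z
  have hmem : x + ε • (z - x) ∈ openSegment ℝ z x := by
    rw [openSegment_symm, openSegment_eq_image']
    exact mem_image_of_mem _ hε
  have hcells := hT.cellsAt_subset_of_mem_openSegment hP.1 hP.2 (h.mem P hP) hmem
  exact (sInter_subset_sInter hcells).trans
    (hT.core_subset_of_isTilingFace (hT.isTilingFace_core z') hεz')

lemma core_eq_of_planeCoord_eq (h : IsRidgeFlag T e₁ e₂ x z) (h' : IsRidgeFlag T e₁ e₂ x z')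
    (hT : IsNormalTiling T) {t : ℝ} (ht : 0 ≤ t)
    (hzz' : planeCoord e₁ e₂ (z - x) = t • planeCoord e₁ e₂ (z' - x)) :
    core T z = core T z' := by
  have ht0 : t ≠ 0 := by
    rintro rfl
    exact h.planeCoord_ne_zero hT (by simpa using hzz')
  refine (h.core_subset_of_planeCoord_eq h' hT ht hzz').antisymm
    (h'.core_subset_of_planeCoord_eq h hT (inv_nonneg.2 ht) ?_)
  rw [hzz', inv_smul_smul₀ ht0]

lemma isTraversalNormal (h : IsRidgeFlag T e₁ e₂ x z) (hT : IsNormalTiling T) :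
    IsTraversalNormal (core T x) e₁ e₂ (core T z)
      (quarterTurn e₁ e₂ (planeCoord e₁ e₂ (z - x))) := by
  set c := planeCoord e₁ e₂ (z - x)
  have hc : ‖c‖ ≠ 0 := norm_ne_zero_iff.2 (h.planeCoord_ne_zero hT)
  refine ⟨(‖c‖⁻¹ • c).re, (‖c‖⁻¹ • c).im, ?_, fun y hy y' hy' => ?_, ?_⟩
  · have hnorm : ‖‖c‖⁻¹ • c‖ = 1 := norm_smul_inv_norm (norm_ne_zero_iff.1 hc)
    rw [pow_two, pow_two, ← Complex.normSq_apply, Complex.normSq_eq_norm_sq, hnorm, one_pow]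
  · obtain ⟨t, ht, hty⟩ := h.exists_planeCoord_eq hT hy'
    have hxy := LinearMap.mem_ker.1 (h.ker_planeCoord.ge (sub_mem_vectorSpan hy (mem_core T x)))
    refine ⟨t * ‖c‖, by positivity, ?_⟩
    change y' - y - (t * ‖c‖) • planeLift e₁ e₂ (‖c‖⁻¹ • c) ∈ _
    rw [← h.ker_planeCoord, LinearMap.mem_ker, map_sub, map_smul, h.frame.planeCoord_planeLift,
      mul_smul, smul_inv_smul₀ hc, ← hty, ← map_sub, ← hxy]
    congr 1
    abel
  · simp [quarterTurn, planeLift]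

lemma inner_quarterTurn (h : IsRidgeFlag T e₁ e₂ x z) (hT : IsNormalTiling T)
    (hv : v ∈ vectorSpan ℝ (core T z)) :
    ⟪quarterTurn e₁ e₂ (planeCoord e₁ e₂ (z - x)), v⟫_ℝ = 0 := by
  set n := quarterTurn e₁ e₂ (planeCoord e₁ e₂ (z - x))
  refine vectorSpan_le_ker (l := (innerₛₗ ℝ n)) (c := ⟪n, x⟫_ℝ) (fun y hy => ?_) hv
  obtain ⟨t, -, ht⟩ := h.exists_planeCoord_eq hT hy
  rw [innerₛₗ_apply_apply, ← sub_eq_zero, ← inner_sub_right, inner_quarterTurn_eq_zero ht]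

lemma eventually_mem_sector (h : IsRidgeFlag T e₁ e₂ x z) (hT : IsNormalTiling T)
    (hadj : AdjacentCells T P Q) (hzPQ : core T z = P ∩ Q)
    (hn : IsUnitNormalFromTo P Q (quarterTurn e₁ e₂ (planeCoord e₁ e₂ (z - x)))) :
    ∀ᶠ δ : ℝ in 𝓝[>] 0, (1 - δ * Complex.I) * planeCoord e₁ e₂ (z - x) ∈ sector e₁ e₂ x P ∧
      (1 + δ * Complex.I) * planeCoord e₁ e₂ (z - x) ∈ sector e₁ e₂ x Q := by
  set c := planeCoord e₁ e₂ (z - x)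
  set n := quarterTurn e₁ e₂ c
  have hz : z ∈ P ∩ Q := hzPQ ▸ mem_core T z
  have hr : 0 < ‖c‖ := norm_pos_iff.2 (h.planeCoord_ne_zero hT)
  have hcells : ∀ R ∈ cellsAt T z, R = P ∨ R = Q := fun R hR =>
    hT.eq_or_eq_of_codim_le_one h.facet.ge ⟨hadj.1, hz.1⟩ ⟨hadj.2.1, hz.2⟩ hR hadj.2.2.1
  have hinner : ∀ δ : ℝ, ⟪n, z + δ • ‖c‖ • n⟫_ℝ = ⟪n, z⟫_ℝ + δ * ‖c‖ := fun δ => by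
    rw [inner_add_right, inner_smul_right, inner_smul_right, real_inner_self_eq_norm_sq, hn.1]
    ring
  have hcoord : ∀ δ : ℝ, planeCoord e₁ e₂ (z + δ • ‖c‖ • n - x) = (1 + δ * Complex.I) * c :=
    fun δ => by
      rw [add_sub_right_comm, map_add, map_smul, h.frame.planeCoord_norm_smul_quarterTurn,
        Complex.real_smul]
      ring
  filter_upwards [eventually_add_smul_mem (hT.eventually_mem_interior hn hz hcells) (-(‖c‖ • n)),
    eventually_add_smul_mem (hT.eventually_mem_interior hn.symm hz.symm fun R hR =>
      (hcells R hR).symm) (‖c‖ • n), self_mem_nhdsWithin] with δ hP hQ hδ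
  have hδr : 0 < δ * ‖c‖ := mul_pos hδ hr
  constructor
  · rw [smul_neg, ← neg_smul] at hP
    refine ⟨_, hP ?_, ?_⟩
    · linarith [hinner (-δ)]
    · simpa [sub_eq_add_neg] using hcoord (-δ)
  · refine ⟨_, hQ ?_, hcoord δ⟩
    rw [inner_neg_left, inner_neg_left, neg_lt_neg_iff, hinner]
    linarith

end IsRidgeFlag

lemma IsTilingFacet.isRidgeFlag (hH : IsTilingFacet T P) (hxP : x ∈ P) (hz : core T z = P)
    (he : IsTraversalFrame (core T x) e₁ e₂) (hx : affDim (core T x) + 2 = d) :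
    IsRidgeFlag T e₁ e₂ x z :=
  ⟨he, hx, hz ▸ hH.2, hz ▸ hxP⟩

namespace IsNormalTiling

variable {s : Set (Ed d) → ℝ} {Z : Set (Ed d) → Ed d}

lemma sum_smul_quarterTurn_eq_zero (hT : IsNormalTiling T) (hs : IsCanonicalScaling T s)
    (he : IsTraversalFrame (core T x) e₁ e₂) (hx : affDim (core T x) + 2 = d)
    (hZ : ∀ H, IsTilingFacet T H → core T (Z H) = H) :
    ∑ H ∈ (hT.finite_facets_at x).toFinset,
      s H • quarterTurn e₁ e₂ (planeCoord e₁ e₂ (Z H - x)) = 0 := by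
  rw [← hs.2 (core T x) ⟨hT.isTilingFace_core x, hx⟩ e₁ e₂ he
    (fun H => quarterTurn e₁ e₂ (planeCoord e₁ e₂ (Z H - x))) fun H hH hxH => ?_]
  · have hmem : ∀ H, (IsTilingFacet T H ∧ core T x ⊆ H) ↔ (IsTilingFacet T H ∧ x ∈ H) := fun H =>
      and_congr_right fun hH => ⟨fun h => h (mem_core T x), hT.core_subset_of_isTilingFace hH.1⟩
    simp only [torsion, hmem]
    exact (finsum_mem_eq_finite_toFinset_sum _ (hT.finite_facets_at x)).symm
  · have hflag := hH.isRidgeFlag (hxH (mem_core T x)) (hZ H hH) he hx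
    simpa only [hZ H hH] using hflag.isTraversalNormal hT

lemma exists_potential_quarterTurn (hT : IsNormalTiling T) (hs : IsCanonicalScaling T s)
    (he : IsTraversalFrame (core T x) e₁ e₂) (hx : affDim (core T x) + 2 = d)
    (hZ : ∀ H, IsTilingFacet T H → core T (Z H) = H) :
    ∃ a : Set (Ed d) → Ed d, ∀ P ∈ cellsAt T x, ∀ Q ∈ cellsAt T x, AdjacentCells T P Q →
      IsUnitNormalFromTo P Q (quarterTurn e₁ e₂ (planeCoord e₁ e₂ (Z (P ∩ Q) - x))) →
      a Q - a P = s (P ∩ Q) • quarterTurn e₁ e₂ (planeCoord e₁ e₂ (Z (P ∩ Q) - x)) := by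
  set J := (hT.finite_facets_at x).toFinset
  set u : Set (Ed d) → ℂ := fun H => planeCoord e₁ e₂ (Z H - x)
  have hflag : ∀ H ∈ J, IsRidgeFlag T e₁ e₂ x (Z H) := fun H hH => by
    obtain ⟨hfacet, hxH⟩ := (hT.finite_facets_at x).mem_toFinset.1 hH
    exact hfacet.isRidgeFlag hxH (hZ H hfacet) he hx
  have hsector : ∀ P ∈ cellsAt T x, ∀ c ∈ sector e₁ e₂ x P, ∀ H ∈ J,
      -c / u H ∈ Complex.slitPlane := fun P hP c hc H hH =>
    neg_div_mem_slitPlane ((hflag H hH).planeCoord_ne_zero hT) fun t ht hct =>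
      (hflag H hH).notMem_sector hT hP ht (hct ▸ hc)
  have hrays : ∀ H ∈ J, ∀ H' ∈ J, H' ≠ H → -u H / u H' ∈ Complex.slitPlane :=
    fun H hH H' hH' hne =>
      neg_div_mem_slitPlane ((hflag H' hH').planeCoord_ne_zero hT) fun t ht htu => hne <| by
        have heq := (hflag H hH).core_eq_of_planeCoord_eq (hflag H' hH') hT ht htu
        rwa [hZ H ((hT.finite_facets_at x).mem_toFinset.1 hH).1,
          hZ H' ((hT.finite_facets_at x).mem_toFinset.1 hH').1, eq_comm] at heq
  choose! Y hY using hT.fullDim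
  refine ⟨fun P => argSum J u (fun H => s H • quarterTurn e₁ e₂ (u H)) (planeCoord e₁ e₂ (Y P - x)),
    fun P hP Q hQ hadj hn => ?_⟩
  have hH : P ∩ Q ∈ J := (hT.finite_facets_at x).mem_toFinset.2 ⟨hadj.2.2.2, hP.2, hQ.2⟩
  exact argSum_sub_argSum (hT.sum_smul_quarterTurn_eq_zero hs he hx hZ) hH
    ((hflag _ hH).planeCoord_ne_zero hT) (hrays _ hH) (hT.isPreconnected_sector hP.1 e₁ e₂ x)
    (hT.isPreconnected_sector hQ.1 e₁ e₂ x) (hsector P hP) (hsector Q hQ)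
    ((hflag _ hH).eventually_mem_sector hT hadj (hZ _ hadj.2.2.2) hn).frequently
    (mem_image_of_mem _ (hY P hP.1)) (mem_image_of_mem _ (hY Q hQ.1))

lemma exists_potential_ridge (hT : IsNormalTiling T) (hs : IsCanonicalScaling T s)
    (hx : affDim (core T x) + 2 = d) :
    ∃ a : Set (Ed d) → Ed d, ∀ P ∈ cellsAt T x, ∀ Q ∈ cellsAt T x, AdjacentCells T P Q →
      ∀ n, IsUnitNormalFromTo P Q n → a Q - a P = s (P ∩ Q) • n := by
  obtain ⟨e₁, e₂, he⟩ := exists_isTraversalFrame hx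
  choose! Z hZ using fun H => hT.exists_core_eq_facet (H := H)
  obtain ⟨a, ha⟩ := hT.exists_potential_quarterTurn hs he hx hZ
  refine ⟨a, fun P hP Q hQ hadj n hn => ?_⟩
  have hflag := hadj.2.2.2.isRidgeFlag ⟨hP.2, hQ.2⟩ (hZ _ hadj.2.2.2) he hx
  have hdim : Module.finrank ℝ (Ed d) ≤ Module.finrank ℝ (vectorSpan ℝ (P ∩ Q)) + 1 := by
    rw [finrank_euclideanSpace_fin]
    exact hadj.affDim.ge
  rcases eq_or_eq_neg_of_unit_normals hdim hn.1
    (he.norm_quarterTurn (hflag.planeCoord_ne_zero hT)) hn.2.1.2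
    (fun v hv => hflag.inner_quarterTurn hT ((hZ _ hadj.2.2.2).symm ▸ hv)) with hturn | hturn
  · rw [← hturn] at hn ⊢
    exact ha P hP Q hQ hadj hn
  · have hflip := ha Q hQ P hP hadj.symm (by rw [inter_comm Q P, hturn]; exact hn.symm)
    rw [inter_comm Q P, hturn, smul_neg] at hflip
    rw [← neg_sub, hflip, neg_neg]

end IsNormalTiling

end Ridge

section Holonomy

variable {d : ℕ} {T : Set (Set (Ed d))} {P Q : Set (Ed d)} {x y : Ed d} {W : Type*}
  [AddCommGroup W] {jump : Set (Ed d) → Set (Ed d) → W} {a b : Set (Ed d) → W}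

/-- The differences of `a` between adjacent cells containing `x` are given by `jump`. -/
def IsPotentialAt (T : Set (Set (Ed d))) (jump : Set (Ed d) → Set (Ed d) → W)
    (a : Set (Ed d) → W) (x : Ed d) : Prop :=
  ∀ P ∈ cellsAt T x, ∀ Q ∈ cellsAt T x, AdjacentCells T P Q → a Q - a P = jump P Q

/-- A potential at every point of the segment from `x` to `y`, normalized to vanish on `P₀`. -/
structure IsRadialPotential (T : Set (Set (Ed d))) (jump : Set (Ed d) → Set (Ed d) → W)
    (P₀ : Set (Ed d)) (x : Ed d) (a : Set (Ed d) → W) (y : Ed d) : Prop where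
  base : a P₀ = 0
  potential : ∀ t ∈ Icc (0 : ℝ) 1, IsPotentialAt T jump a (AffineMap.lineMap x y t)

lemma IsPotentialAt.eventually (ha : IsPotentialAt T jump a x) (hT : IsNormalTiling T) :
    ∀ᶠ y in 𝓝 x, IsPotentialAt T jump a y := by
  filter_upwards [hT.eventually_cellsAt_subset x] with y hy P hP Q hQ
  exact ha P (hy hP) Q (hy hQ)

lemma IsPotentialAt.sub_eq_sub (ha : IsPotentialAt T jump a x) (hb : IsPotentialAt T jump b x)
    (hT : IsNormalTiling T) (hP : P ∈ cellsAt T x) (hQ : Q ∈ cellsAt T x) :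
    a Q - b Q = a P - b P := by
  refine hT.cellsAt_induction (Φ := fun R => a R - b R = a P - b P) hP hQ rfl ?_
  intro R hR S hS hadj hRP
  rw [← hRP, sub_eq_sub_iff_sub_eq_sub, ha R hR S hS hadj, hb R hR S hS hadj]

namespace IsNormalTiling

lemma exists_potential_union (hT : IsNormalTiling T) (γ : ℝ →ᵃ[ℝ] Ed d) {t₁ t₂ : ℝ} (h₁ : 0 ≤ t₁)
    (h₂ : t₁ ≤ t₂) (ha : ∀ t ∈ Icc 0 t₁, IsPotentialAt T jump a (γ t))
    (hb : ∀ t ∈ Icc t₁ t₂, IsPotentialAt T jump b (γ t)) :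
    ∃ c, ∀ t ∈ Icc 0 t₂, IsPotentialAt T jump c (γ t) := by
  classical
  obtain ⟨P₁, hP₁⟩ := hT.cellsAt_nonempty (γ t₁)
  let c : Set (Ed d) → W := fun P =>
    if ∃ r ∈ Icc 0 t₁, γ r ∈ P then a P else b P + (a P₁ - b P₁)
  have hca : ∀ t ∈ Icc 0 t₁, ∀ P ∈ cellsAt T (γ t), c P = a P := fun t ht P hP =>
    if_pos ⟨t, ht, hP.2⟩
  have hcb : ∀ t ∈ Icc t₁ t₂, ∀ P ∈ cellsAt T (γ t), c P = b P + (a P₁ - b P₁) := by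
    intro t ht P hP
    by_cases hex : ∃ r ∈ Icc 0 t₁, γ r ∈ P
    · obtain ⟨r, hr, hrP⟩ := hex
      have hγP : γ t₁ ∈ P :=
        ((hT.convex hP.1).affine_preimage γ).ordConnected.out hrP hP.2 ⟨hr.2, ht.1⟩
      rw [hca t₁ ⟨h₁, le_rfl⟩ P ⟨hP.1, hγP⟩, ← (ha t₁ ⟨h₁, le_rfl⟩).sub_eq_sub
        (hb t₁ ⟨le_rfl, h₂⟩) hT hP₁ ⟨hP.1, hγP⟩, add_sub_cancel]
    · exact if_neg hex
  refine ⟨c, fun t ht P hP Q hQ hadj => ?_⟩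
  rcases le_total t t₁ with htt | htt
  · rw [hca t ⟨ht.1, htt⟩ P hP, hca t ⟨ht.1, htt⟩ Q hQ]
    exact ha t ⟨ht.1, htt⟩ P hP Q hQ hadj
  · rw [hcb t ⟨htt, ht.2⟩ P hP, hcb t ⟨htt, ht.2⟩ Q hQ, add_sub_add_right_eq_sub]
    exact hb t ⟨htt, ht.2⟩ P hP Q hQ hadj

lemma exists_potential_line (hT : IsNormalTiling T) (γ : ℝ →ᵃ[ℝ] Ed d) {τ : ℝ} (hτ : 0 ≤ τ)
    (hloc : ∀ t ∈ Icc 0 τ, ∃ a, IsPotentialAt T jump a (γ t)) :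
    ∃ a, ∀ t ∈ Icc 0 τ, IsPotentialAt T jump a (γ t) := by
  have hext : ∀ t ∈ Icc 0 τ, ∃ ε > 0, ∃ b, ∀ r ∈ Metric.ball t ε, IsPotentialAt T jump b (γ r) := by
    intro t ht
    obtain ⟨b, hb⟩ := hloc t ht
    obtain ⟨ε, hε, hball⟩ := Metric.eventually_nhds_iff_ball.1
      ((γ.continuous_of_finiteDimensional.tendsto t).eventually (hb.eventually hT))
    exact ⟨ε, hε, b, hball⟩
  have hball : ∀ {t ε r₁ r₂ r : ℝ}, t - ε < r₁ → r₂ < t + ε → r ∈ Icc r₁ r₂ →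
      r ∈ Metric.ball t ε := fun h₁ h₂ hr => by
    rw [Real.ball_eq_Ioo]
    exact ⟨h₁.trans_le hr.1, hr.2.trans_lt h₂⟩
  refine real_induction (good := fun τ => ∃ a, ∀ t ∈ Icc 0 τ, IsPotentialAt T jump a (γ t))
    ?_ ?_ ?_ τ hτ le_rfl
  · obtain ⟨a, ha⟩ := hloc 0 ⟨le_rfl, hτ⟩
    refine ⟨a, fun t ht => ?_⟩
    rwa [le_antisymm ht.2 ht.1]
  · rintro t ht0 htτ ⟨a, ha⟩
    obtain ⟨ε, hε, b, hb⟩ := hext t ⟨ht0, htτ.le⟩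
    filter_upwards [Ioo_mem_nhdsGT (lt_add_of_pos_right t hε)] with t' ht'
    exact hT.exists_potential_union γ ht0 ht'.1.le ha fun r hr =>
      hb r (hball (sub_lt_self t hε) ht'.2 hr)
  · intro t ht0 htτ hbefore
    obtain ⟨ε, hε, b, hb⟩ := hext t ⟨ht0.le, htτ⟩
    obtain ⟨t', ht', htt'⟩ := exists_between (max_lt ht0 (sub_lt_self t hε))
    have ht'0 : 0 ≤ t' := (le_max_left _ _).trans ht'.le
    obtain ⟨a, ha⟩ := hbefore t' ht'0 htt'
    exact hT.exists_potential_union γ ht'0 htt'.le ha fun r hr =>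
      hb r (hball ((le_max_right _ _).trans_lt ht') (lt_add_of_pos_right t hε) hr)

lemma exists_isRadialPotential (hT : IsNormalTiling T) (P₀ : Set (Ed d)) (x₀ y : Ed d)
    (hloc : ∀ t ∈ Icc (0 : ℝ) 1, ∃ a, IsPotentialAt T jump a (AffineMap.lineMap x₀ y t)) :
    ∃ a, IsRadialPotential T jump P₀ x₀ a y := by
  obtain ⟨a, ha⟩ := hT.exists_potential_line (AffineMap.lineMap x₀ y) zero_le_one hloc
  refine ⟨fun P => a P - a P₀, sub_self _, fun t ht P hP Q hQ hadj => ?_⟩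
  rw [sub_sub_sub_cancel_right]
  exact ha t ht P hP Q hQ hadj

lemma exists_isRadialPotential_of_notMem_joinPoint (hT : IsNormalTiling T) {P₀ : Set (Ed d)}
    {x₀ : Ed d} (hloc : ∀ x, (∀ A ∈ skel T 3, x ∉ A) → ∃ a, IsPotentialAt T jump a x)
    (hx₀ : cellsAt T x₀ ⊆ {P₀}) (hy : ∀ A ∈ joinPoint x₀ '' skel T 3, y ∉ A) :
    ∃ a, IsRadialPotential T jump P₀ x₀ a y := by
  refine hT.exists_isRadialPotential P₀ x₀ y fun t ht => ?_
  rcases ht.1.eq_or_lt with rfl | ht0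
  · refine ⟨0, fun P hP Q hQ hadj => absurd ?_ hadj.2.2.1⟩
    rw [AffineMap.lineMap_apply_zero] at hP hQ
    rw [hx₀ hP, hx₀ hQ]
  · exact hloc _ fun A hA hmem =>
      hy _ (mem_image_of_mem _ hA) (mem_joinPoint_of_lineMap_mem ht0.ne' hmem)

end IsNormalTiling

namespace IsRadialPotential

variable {P₀ : Set (Ed d)} {x₀ : Ed d} {α : Ed d → Set (Ed d) → W}
  {𝒜 : Set (AffineSubspace ℝ (Ed d))}

lemma isPotentialAt (ha : IsRadialPotential T jump P₀ x₀ a y) : IsPotentialAt T jump a y := by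
  simpa using ha.potential 1 ⟨zero_le_one, le_rfl⟩

lemma eventually (ha : IsRadialPotential T jump P₀ x₀ a y) (hT : IsNormalTiling T) :
    ∀ᶠ y' in 𝓝 y, IsRadialPotential T jump P₀ x₀ a y' := by
  have hnear : ∀ᶠ y' in 𝓝 y, ∀ t ∈ Icc (0 : ℝ) 1,
      IsPotentialAt T jump a (AffineMap.lineMap x₀ y' t) := by
    refine isCompact_Icc.eventually_forall_of_forall_eventually fun t ht => ?_
    have hcont : Continuous fun z : Ed d × ℝ => (AffineMap.lineMap x₀ z.1 z.2 : Ed d) := by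
      simp only [AffineMap.lineMap_apply_module']
      fun_prop
    exact (hcont.tendsto (y, t)).eventually ((ha.potential t ht).eventually hT)
  filter_upwards [hnear] with y' hy' using ⟨ha.base, hy'⟩

lemma eq_of_mem_cellsAt (ha : IsRadialPotential T jump P₀ x₀ a y)
    (hb : IsRadialPotential T jump P₀ x₀ b y) (hT : IsNormalTiling T)
    (hx₀ : cellsAt T x₀ ⊆ {P₀}) (hP : P ∈ cellsAt T y) : a P = b P := by
  refine hT.cell_induction (γ := AffineMap.lineMap x₀ y) (τ := 1) (Φ := fun P => a P = b P)
    AffineMap.lineMap_continuous (fun Q hQ => ?_) (fun t ht0 ht1 Q hQ R hR _ heq => ?_) 1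
    zero_le_one le_rfl P (by rwa [AffineMap.lineMap_apply_one])
  · rw [AffineMap.lineMap_apply_zero] at hQ
    rw [hx₀ hQ, ha.base, hb.base]
  · have hsub := (ha.potential t ⟨ht0.le, ht1⟩).sub_eq_sub (hb.potential t ⟨ht0.le, ht1⟩) hT hQ hR
    rwa [heq, sub_self, sub_eq_zero] at hsub

lemma eq_of_mem_cell (hT : IsNormalTiling T) (hx₀ : cellsAt T x₀ ⊆ {P₀}) (h𝒜 : 𝒜.Countable)
    (hdim : ∀ A ∈ 𝒜, Module.finrank ℝ A.direction + 2 ≤ d)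
    (hα : ∀ y, (∀ A ∈ 𝒜, y ∉ A) → IsRadialPotential T jump P₀ x₀ (α y) y) (hP : P ∈ T)
    (hy : y ∈ P) (hy𝒜 : ∀ A ∈ 𝒜, y ∉ A) {z : Ed d} (hz : z ∈ P) (hz𝒜 : ∀ A ∈ 𝒜, z ∉ A) :
    α y P = α z P := by
  have hpre : IsPreconnected {y ∈ P | ∀ A ∈ 𝒜, y ∉ A} :=
    isPreconnected_setOf_forall_notMem (hT.convex hP) h𝒜 fun A hA => by
      rw [affDim_eq_finrank_of_interior_nonempty (hT.fullDim P hP), finrank_euclideanSpace_fin]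
      exact hdim A hA
  refine hpre.induction₂ (fun y z => α y P = α z P) (fun y hy => ?_) (fun _ _ _ _ _ _ => Eq.trans)
    (fun _ _ _ _ => Eq.symm) ⟨hy, hy𝒜⟩ ⟨hz, hz𝒜⟩
  filter_upwards [((hα y hy.2).eventually hT).filter_mono nhdsWithin_le_nhds, self_mem_nhdsWithin]
    with y' hyy' hy'
  exact hyy'.eq_of_mem_cellsAt (hα y' hy'.2) hT hx₀ ⟨hP, hy'.1⟩

end IsRadialPotential

lemma IsNormalTiling.exists_potential (hT : IsNormalTiling T)
    (hloc : ∀ x, (∀ A ∈ skel T 3, x ∉ A) → ∃ a, IsPotentialAt T jump a x) :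
    ∃ a : Set (Ed d) → W, ∀ P Q, AdjacentCells T P Q → a Q - a P = jump P Q := by
  obtain ⟨P₀, hP₀, -⟩ := hT.cellsAt_nonempty 0
  obtain ⟨x₀, hx₀P₀⟩ := hT.fullDim P₀ hP₀
  have hx₀ : cellsAt T x₀ ⊆ {P₀} := fun P hP => (hT.eq_of_mem_interior hP₀ hP.1 hx₀P₀ hP.2).symm
  -- The shadows of the faces of codimension three, seen from `x₀`, still have codimension two.
  set 𝒜 := joinPoint x₀ '' skel T 3
  have h𝒜 : 𝒜.Countable := (hT.countable_skel 3).image _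
  have hdim : ∀ A ∈ 𝒜, Module.finrank ℝ A.direction + 2 ≤ d := by
    rintro _ ⟨A, hA, rfl⟩
    have hskel := finrank_direction_of_mem_skel hA
    have hjoin := finrank_joinPoint_le x₀ A
    omega
  choose! α hα using fun y => hT.exists_isRadialPotential_of_notMem_joinPoint (y := y) hloc hx₀
  have hpoint : ∀ P ∈ T, ∃ y ∈ P, ∀ A ∈ 𝒜, y ∉ A := fun P hP =>
    exists_mem_forall_notMem_of_convex (hT.convex hP) ((hT.fullDim P hP).mono interior_subset) h𝒜
      fun A hA => by
        rw [affDim_eq_finrank_of_interior_nonempty (hT.fullDim P hP), finrank_euclideanSpace_fin]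
        exact lt_of_lt_of_le (by omega) (hdim A hA)
  choose! p hpP hp𝒜 using hpoint
  refine ⟨fun P => α (p P) P, fun P Q hadj => ?_⟩
  obtain ⟨y, hy, hy𝒜⟩ := hT.exists_mem_inter_forall_notMem hadj h𝒜 hdim
  have heq : ∀ R ∈ T, y ∈ R → α (p R) R = α y R := fun R hR hyR =>
    IsRadialPotential.eq_of_mem_cell hT hx₀ h𝒜 hdim hα hR (hpP R hR) (hp𝒜 R hR) hyR hy𝒜
  simp only [heq P hadj.1 hy.1, heq Q hadj.2.1 hy.2]
  exact (hα y hy𝒜).isPotentialAt P ⟨hadj.1, hy.1⟩ Q ⟨hadj.2.1, hy.2⟩ hadj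

end Holonomy

section AffinePieces

variable {d : ℕ} {T : Set (Set (Ed d))} {s : Set (Ed d) → ℝ} {P Q : Set (Ed d)}
  {n w x y z : Ed d} {g : Set (Ed d) → Ed d} {c : Set (Ed d) → ℝ} {G : Ed d → ℝ}

/-- The affine functions `x ↦ ⟪g P, x⟫ + c P` agree on common facets of the cells `P`, and their
gradients change across facets as prescribed by `s`. -/
structure IsAffineGluing (T : Set (Set (Ed d))) (s : Set (Ed d) → ℝ) (g : Set (Ed d) → Ed d)
    (c : Set (Ed d) → ℝ) : Prop where
  step : ∀ P Q, AdjacentCells T P Q → ∀ n, IsUnitNormalFromTo P Q n → g Q = g P + s (P ∩ Q) • n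
  glue : ∀ P Q, AdjacentCells T P Q → ∀ x ∈ P ∩ Q, ⟪g Q, x⟫_ℝ + c Q = ⟪g P, x⟫_ℝ + c P

/-- `G` is on every cell the affine function given by the gluing `g, c`, and it is the maximum of
these affine functions. -/
structure IsGeneratrixFunction (T : Set (Set (Ed d))) (s : Set (Ed d) → ℝ)
    (g : Set (Ed d) → Ed d) (c : Set (Ed d) → ℝ) (G : Ed d → ℝ) : Prop
    extends IsAffineGluing T s g c where
  eq : ∀ P ∈ T, ∀ x ∈ P, G x = ⟪g P, x⟫_ℝ + c P
  le : ∀ P ∈ T, ∀ x, ⟪g P, x⟫_ℝ + c P ≤ G x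

lemma IsUnitNormalFromTo.inner_eq_inner (hn : IsUnitNormalFromTo P Q n) (hx : x ∈ P ∩ Q)
    (hy : y ∈ P ∩ Q) : ⟪n, x⟫_ℝ = ⟪n, y⟫_ℝ := by
  rw [← sub_eq_zero, ← inner_sub_right, hn.2.1.2 _ (sub_mem_vectorSpan hy hx)]

lemma IsUnitNormalFromTo.inner_le_inner_of_mem_openSegment (hn : IsUnitNormalFromTo P Q n)
    (hw : w ∈ P) (hz : z ∈ P ∩ Q) (hzwx : z ∈ openSegment ℝ w x) : ⟪n, z⟫_ℝ ≤ ⟪n, x⟫_ℝ := by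
  obtain ⟨α, β, hα, hβ, hαβ, rfl⟩ := hzwx
  have hle := (hn.2.2 _ hz).1 w hw
  simp only [inner_add_right, inner_smul_right] at hle ⊢
  rw [← eq_sub_iff_add_eq] at hαβ
  subst hαβ
  nlinarith

namespace IsNormalTiling

lemma exists_gradient_at (hT : IsNormalTiling T) (hs : IsCanonicalScaling T s)
    (hx : ∀ A ∈ skel T 3, x ∉ A) :
    ∃ a : Set (Ed d) → Ed d, ∀ P ∈ cellsAt T x, ∀ Q ∈ cellsAt T x, AdjacentCells T P Q →
      ∀ n, IsUnitNormalFromTo P Q n → a Q - a P = s (P ∩ Q) • n := by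
  classical
  by_cases hridge : affDim (core T x) + 2 = d
  · exact hT.exists_potential_ridge hs hridge
  have hcodim : d ≤ affDim (core T x) + 1 := by
    have hcore := hT.lt_affDim_core hx
    omega
  obtain ⟨P, hP⟩ := hT.cellsAt_nonempty x
  have hnormal : ∀ R ∈ cellsAt T x, R ≠ P → ∃ n, IsUnitNormalFromTo P R n := fun R hR hne =>
    hT.exists_unitNormal hP.1 hR.1 hne.symm
  choose! ν hν using hnormal
  refine ⟨fun R => if R = P then 0 else s (P ∩ R) • ν R, fun R hR S hS hadj n hn => ?_⟩
  have hne := hadj.2.2.1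
  beta_reduce
  rcases hT.eq_or_eq_of_codim_le_one hcodim hR hS hP hne with rfl | rfl
  · rw [if_neg hne.symm, if_pos rfl, sub_zero, hT.unitNormal_unique hadj hn (hν S hS hne.symm)]
  · rw [if_pos rfl, if_neg hne, zero_sub, hT.unitNormal_unique hadj.symm hn.symm (hν R hR hne),
      smul_neg, neg_neg, inter_comm]

lemma exists_isAffineGluing (hT : IsNormalTiling T) (hs : IsCanonicalScaling T s)
    (P₀ : Set (Ed d)) : ∃ g c, g P₀ = 0 ∧ c P₀ = 0 ∧ IsAffineGluing T s g c := by
  have hnormal : ∀ P Q, AdjacentCells T P Q → ∃ n, IsUnitNormalFromTo P Q n := fun P Q h =>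
    hT.exists_unitNormal h.1 h.2.1 h.2.2.1
  choose! ν hν using hnormal
  have hpoint : ∀ P Q, AdjacentCells T P Q → ∃ y, y ∈ P ∩ Q := fun P Q h => h.nonempty
  choose! y hy using hpoint
  let jump : Set (Ed d) → Set (Ed d) → Ed d × ℝ := fun P Q =>
    (s (P ∩ Q) • ν P Q, -⟪s (P ∩ Q) • ν P Q, y P Q⟫_ℝ)
  have hinner : ∀ P Q, AdjacentCells T P Q → ∀ x ∈ P ∩ Q,
      ⟪s (P ∩ Q) • ν P Q, x⟫_ℝ = ⟪s (P ∩ Q) • ν P Q, y P Q⟫_ℝ := fun P Q h x hx => by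
    rw [real_inner_smul_left, real_inner_smul_left, (hν P Q h).inner_eq_inner hx (hy P Q h)]
  have hlocal : ∀ x, (∀ A ∈ skel T 3, x ∉ A) → ∃ a, IsPotentialAt T jump a x := fun x hx => by
    obtain ⟨b, hb⟩ := hT.exists_gradient_at hs hx
    refine ⟨fun P => (b P, -⟪b P, x⟫_ℝ), fun P hP Q hQ hadj => ?_⟩
    have hbPQ := hb P hP Q hQ hadj _ (hν P Q hadj)
    refine Prod.ext hbPQ ?_
    change -⟪b Q, x⟫_ℝ - -⟪b P, x⟫_ℝ = -⟪s (P ∩ Q) • ν P Q, y P Q⟫_ℝ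
    rw [← hinner P Q hadj x ⟨hP.2, hQ.2⟩, ← hbPQ, inner_sub_left]
    ring
  obtain ⟨a, ha⟩ := hT.exists_potential hlocal
  have hfst : ∀ P Q, AdjacentCells T P Q → (a Q).1 - (a P).1 = s (P ∩ Q) • ν P Q :=
    fun P Q h => congrArg Prod.fst (ha P Q h)
  have hsnd : ∀ P Q, AdjacentCells T P Q → (a Q).2 - (a P).2 = -⟪s (P ∩ Q) • ν P Q, y P Q⟫_ℝ :=
    fun P Q h => congrArg Prod.snd (ha P Q h)
  refine ⟨fun P => (a P).1 - (a P₀).1, fun P => (a P).2 - (a P₀).2, sub_self _, sub_self _,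
    fun P Q hadj n hn => ?_, fun P Q hadj x hx => ?_⟩
  · rw [hT.unitNormal_unique hadj (hν P Q hadj) hn, ← hfst P Q hadj, sub_add_sub_cancel']
  · have hjump := hsnd P Q hadj
    rw [← hinner P Q hadj x hx, ← hfst P Q hadj, inner_sub_left] at hjump
    rw [inner_sub_left, inner_sub_left]
    linarith

lemma exists_generic_mem_interior (hT : IsNormalTiling T) (hP : P ∈ T) (x : Ed d) :
    ∃ y ∈ interior P, ∀ t : ℝ, t < 1 → d ≤ affDim (core T (AffineMap.lineMap y x t)) + 1 := by
  obtain ⟨y, hyP, hy⟩ := exists_mem_forall_notMem_of_isOpen (isOpen_interior (s := P))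
      (hT.fullDim P hP) ((hT.countable_skel 2).image (joinPoint x)) <| by
    rintro _ ⟨A, hA, rfl⟩ htop
    have hskel := finrank_direction_of_mem_skel hA
    have hjoin := finrank_joinPoint_le x A
    rw [htop, AffineSubspace.direction_top, finrank_top, finrank_euclideanSpace_fin] at hjoin
    omega
  refine ⟨y, hyP, fun t ht => Nat.le_of_lt_succ (hT.lt_affDim_core (k := 2) fun A hA hmem => ?_)⟩
  refine hy _ (mem_image_of_mem _ hA) (mem_joinPoint_of_lineMap_mem (sub_ne_zero.2 ht.ne') ?_)
  rwa [AffineMap.lineMap_apply_one_sub]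

end IsNormalTiling

namespace IsAffineGluing

lemma eq_of_mem_cellsAt (h : IsAffineGluing T s g c) (hT : IsNormalTiling T) (hP : P ∈ cellsAt T x)
    (hQ : Q ∈ cellsAt T x) : ⟪g Q, x⟫_ℝ + c Q = ⟪g P, x⟫_ℝ + c P :=
  hT.cellsAt_induction (Φ := fun R => ⟪g R, x⟫_ℝ + c R = ⟪g P, x⟫_ℝ + c P) hP hQ rfl
    fun R hR S hS hadj hRP => (h.glue R S hadj x ⟨hR.2, hS.2⟩).trans hRP

lemma sub_eq_mul (h : IsAffineGluing T s g c) (hadj : AdjacentCells T P Q)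
    (hn : IsUnitNormalFromTo P Q n) (hz : z ∈ P ∩ Q) (x : Ed d) :
    (⟪g Q, x⟫_ℝ + c Q) - (⟪g P, x⟫_ℝ + c P) = s (P ∩ Q) * (⟪n, x⟫_ℝ - ⟪n, z⟫_ℝ) := by
  have hglue := h.glue P Q hadj z hz
  rw [h.step P Q hadj n hn, inner_add_left, real_inner_smul_left] at hglue ⊢
  linarith

/-- Along a generic ray into `x`, each crossing of a facet is in the direction of its normal, so it
increases the value at `x` of the current affine function. -/
lemma le_of_mem_cellsAt (h : IsAffineGluing T s g c) (hT : IsNormalTiling T)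
    (hs : IsCanonicalScaling T s) (hP : P ∈ T) (hQ : Q ∈ cellsAt T x) :
    ⟪g P, x⟫_ℝ + c P ≤ ⟪g Q, x⟫_ℝ + c Q := by
  obtain ⟨y, hyP, hy⟩ := hT.exists_generic_mem_interior hP x
  set γ : ℝ →ᵃ[ℝ] Ed d := AffineMap.lineMap y x with hγdef
  have hγ : Continuous γ := γ.continuous_of_finiteDimensional
  have hγ1 : γ 1 = x := AffineMap.lineMap_apply_one _ _
  have hend : ∀ᶠ t in 𝓝 1, cellsAt T (γ t) ⊆ cellsAt T x := by
    simpa only [hγ1] using (hγ.tendsto 1).eventually (hT.eventually_cellsAt_subset (γ 1))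
  obtain ⟨τ, hτ, hτ0, hτ1⟩ :=
    ((hend.filter_mono nhdsWithin_le_nhds).and (Ioo_mem_nhdsLT zero_lt_one)).exists
  obtain ⟨R, hR⟩ := hT.cellsAt_nonempty (γ τ)
  rw [h.eq_of_mem_cellsAt hT (hτ hR) hQ]
  refine hT.cell_induction hγ (τ := τ) (Φ := fun R => ⟪g P, x⟫_ℝ + c P ≤ ⟪g R, x⟫_ℝ + c R)
    (fun S hS => ?_) ?_ τ hτ0.le le_rfl R hR
  · rw [hγdef, AffineMap.lineMap_apply_zero] at hS
    rw [hT.eq_of_mem_interior hP hS.1 hyP hS.2]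
  · rintro t - htτ Q hQ R hR ⟨t', -, ht't, ht'Q⟩ hPQ
    rcases eq_or_ne Q R with rfl | hne
    · exact hPQ
    have hadj := hT.adjacent_of_codim_le_one (hy t (htτ.trans_lt hτ1)) hQ hR hne
    obtain ⟨n, hn⟩ := hT.exists_unitNormal hQ.1 hR.1 hne
    have hmem : γ t ∈ openSegment ℝ (γ t') x := by
      rw [← hγ1, ← image_openSegment, openSegment_eq_Ioo (ht't.trans (htτ.trans_lt hτ1))]
      exact mem_image_of_mem γ ⟨ht't, htτ.trans_lt hτ1⟩
    have hcross := mul_nonneg (hs.1 _ hadj.2.2.2).le (sub_nonneg.2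
      (hn.inner_le_inner_of_mem_openSegment ht'Q ⟨hQ.2, hR.2⟩ hmem))
    rw [← h.sub_eq_mul hadj hn ⟨hQ.2, hR.2⟩, sub_nonneg] at hcross
    exact hPQ.trans hcross

end IsAffineGluing

lemma IsNormalTiling.exists_isGeneratrixFunction (hT : IsNormalTiling T)
    (hs : IsCanonicalScaling T s) (P₀ : Set (Ed d)) :
    ∃ g c G, g P₀ = 0 ∧ c P₀ = 0 ∧ IsGeneratrixFunction T s g c G := by
  obtain ⟨g, c, hg₀, hc₀, h⟩ := hT.exists_isAffineGluing hs P₀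
  choose p hp using hT.cellsAt_nonempty
  exact ⟨g, c, fun x => ⟪g (p x), x⟫_ℝ + c (p x), hg₀, hc₀, h,
    fun P hP x hx => h.eq_of_mem_cellsAt hT ⟨hP, hx⟩ (hp x),
    fun P hP x => h.le_of_mem_cellsAt hT hs hP (hp x)⟩

namespace IsGeneratrixFunction

lemma convexOn (hG : IsGeneratrixFunction T s g c G) (hT : IsNormalTiling T) :
    ConvexOn ℝ univ G := by
  refine ⟨convex_univ, fun x _ y _ α β hα hβ hαβ => ?_⟩
  obtain ⟨P, hP⟩ := hT.cellsAt_nonempty (α • x + β • y)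
  calc G (α • x + β • y) = α • (⟪g P, x⟫_ℝ + c P) + β • (⟪g P, y⟫_ℝ + c P) := by
        rw [hG.eq P hP.1 _ hP.2, inner_add_right, inner_smul_right, inner_smul_right]
        linear_combination (norm := (simp only [smul_eq_mul]; ring)) -c P * hαβ
    _ ≤ α • G x + β • G y := by gcongr <;> exact hG.le P hP.1 _

lemma continuous (hG : IsGeneratrixFunction T s g c G) (hT : IsNormalTiling T) :
    Continuous G := by
  refine hT.locallyFinite.continuous ?_ (fun P => hT.isClosed P.2) fun P => ?_
  · rw [← sUnion_eq_iUnion, hT.cover]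
  · have hcont : Continuous fun x => ⟪g P, x⟫_ℝ + c P := by fun_prop
    exact hcont.continuousOn.congr (hG.eq P P.2)

lemma exists_affineMap (hG : IsGeneratrixFunction T s g c G) (hP : P ∈ T) :
    ∃ a : Ed d →ᵃ[ℝ] ℝ, EqOn G a P :=
  ⟨(innerₛₗ ℝ (g P)).toAffineMap + AffineMap.const ℝ (Ed d) (c P), fun x hx => by
    simpa using hG.eq P hP x hx⟩

end IsGeneratrixFunction

end AffinePieces

section Lifts

variable {d : ℕ} {T : Set (Set (Ed d))} {s : Set (Ed d) → ℝ} {P P₀ Q F : Set (Ed d)}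
  {P' : Set (Ed1 d)} {g : Set (Ed d) → Ed d} {c : Set (Ed d) → ℝ} {G : Ed d → ℝ}
  {m : Ed d} {b : ℝ} {h z w : Ed1 d}

lemma ext_Ed1 (hfst : z.fst = w.fst) (hsnd : z.snd = w.snd) : z = w :=
  WithLp.ofLp_injective 2 (Prod.ext hfst hsnd)

lemma inner_toLp_prodMk (m : Ed d) (b : ℝ) (z : Ed1 d) :
    ⟪(WithLp.toLp 2 (m, b) : Ed1 d), z⟫_ℝ = ⟪m, z.fst⟫_ℝ + b * z.snd := by
  rw [WithLp.prod_inner_apply, real_inner_eq_re_inner, mul_comm]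
  rfl

lemma affDim_image_of_injective {V W : Type*} [NormedAddCommGroup V] [InnerProductSpace ℝ V]
    [NormedAddCommGroup W] [InnerProductSpace ℝ W] (ψ : V →ᵃ[ℝ] W) (hψ : Function.Injective ψ)
    (F : Set V) : affDim (ψ '' F) = affDim F := by
  rw [affDim, ← AffineMap.map_vectorSpan]
  exact (Submodule.equivMapOfInjective _ (ψ.linear_injective_iff.2 hψ) _).finrank_eq.symm

lemma projEd_image_graphOver (G : Ed d → ℝ) (P : Set (Ed d)) : projEd '' graphOver G P = P := by
  ext x
  refine ⟨?_, fun hx => ⟨WithLp.toLp 2 (x, G x), ⟨hx, rfl⟩, rfl⟩⟩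
  rintro ⟨z, hz, rfl⟩
  exact hz.1

lemma graphOver_inter (G : Ed d → ℝ) (P Q : Set (Ed d)) :
    graphOver G P ∩ graphOver G Q = graphOver G (P ∩ Q) := by
  ext z
  exact ⟨fun hz => ⟨⟨hz.1.1, hz.2.1⟩, hz.1.2⟩, fun hz => ⟨⟨hz.1.1, hz.2⟩, ⟨hz.1.2, hz.2⟩⟩⟩

lemma isExposed_graphOver (hF : IsExposed ℝ P F) (G : Ed d → ℝ) :
    IsExposed ℝ (graphOver G P) (graphOver G F) := by
  rintro ⟨z₀, hz₀, -⟩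
  obtain ⟨l, rfl⟩ := hF ⟨_, hz₀⟩
  refine ⟨l.comp (WithLp.fstL 2 ℝ (Ed d) ℝ), ?_⟩
  ext z
  constructor
  · rintro ⟨⟨hzP, hmax⟩, hz⟩
    exact ⟨⟨hzP, hz⟩, fun w hw => hmax w.fst hw.1⟩
  · rintro ⟨⟨hzP, hz⟩, hmax⟩
    exact ⟨⟨hzP, fun y hy => hmax (WithLp.toLp 2 (y, G y)) ⟨hy, rfl⟩⟩, hz⟩

lemma isConvexPolyhedron_graphOver (hP : IsConvexPolyhedron P)
    (hG : ∀ x ∈ P, G x = ⟪m, x⟫_ℝ + b) : IsConvexPolyhedron (graphOver G P) := by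
  classical
  obtain ⟨A, rfl⟩ := hP
  refine ⟨A.image (fun a => ((WithLp.toLp 2 (a.1, 0) : Ed1 d), a.2)) ∪
    {(WithLp.toLp 2 (m, -1), -b), (WithLp.toLp 2 (-m, 1), b)}, ?_⟩
  ext z
  simp only [Finset.mem_union, Finset.mem_image, Finset.mem_insert, Finset.mem_singleton,
    or_imp, forall_and, forall_exists_index, and_imp, forall_apply_eq_imp_iff₂, forall_eq,
    mem_ofPred_eq, inner_toLp_prodMk, inner_neg_left, zero_mul, add_zero]
  refine and_congr_right fun hz => ?_
  rw [hG _ hz]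
  constructor
  · intro hsnd
    constructor <;> linarith
  · rintro ⟨hge, hle⟩
    linarith

lemma graphOver_eq_image (hG : ∀ x ∈ P, G x = ⟪m, x⟫_ℝ + b) :
    ∃ ψ : Ed d →ᵃ[ℝ] Ed1 d, Function.Injective ψ ∧ graphOver G P = ψ '' P := by
  let ψ : Ed d →ᵃ[ℝ] Ed1 d := (WithLp.linearEquiv 2 ℝ (Ed d × ℝ)).symm.toLinearMap.toAffineMap.comp
    ((AffineMap.id ℝ (Ed d)).prod ((innerₛₗ ℝ m).toAffineMap + AffineMap.const ℝ (Ed d) b))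
  have hfst : ∀ x, (ψ x).fst = x := fun x => rfl
  have hsnd : ∀ x, (ψ x).snd = ⟪m, x⟫_ℝ + b := fun x => rfl
  refine ⟨ψ, Function.LeftInverse.injective (g := WithLp.fst) hfst, ?_⟩
  ext z
  constructor
  · rintro ⟨hzP, hz⟩
    exact ⟨z.fst, hzP, ext_Ed1 (hfst _) (by rw [hsnd, hz, hG _ hzP])⟩
  · rintro ⟨x, hx, rfl⟩
    exact ⟨hx, (hG x hx).symm⟩

lemma isLift_graphOver (hP : IsConvexPolyhedron P) (hG : ∀ x ∈ P, G x = ⟪m, x⟫_ℝ + b) :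
    IsLift P (graphOver G P) := by
  refine ⟨isConvexPolyhedron_graphOver hP hG, ?_, projEd_image_graphOver G P⟩
  obtain ⟨ψ, hψ, himg⟩ := graphOver_eq_image hG
  rw [himg, affDim_image_of_injective ψ hψ]

lemma isNormalTo_graphOver (hG : ∀ x ∈ P, G x = ⟪m, x⟫_ℝ + b) :
    IsNormalTo (WithLp.toLp 2 (m, -1) : Ed1 d) (graphOver G P) := by
  refine ⟨fun hzero => ?_, fun v hv => ?_⟩
  · exact neg_ne_zero.2 one_ne_zero (congrArg WithLp.snd hzero : (-1 : ℝ) = 0)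
  · refine vectorSpan_le_ker (l := innerₛₗ ℝ (WithLp.toLp 2 (m, -1) : Ed1 d)) (c := -b)
      (fun z hz => ?_) hv
    rw [innerₛₗ_apply_apply, inner_toLp_prodMk, hz.2, hG _ hz.1]
    ring

lemma eq_graphOver_of_isNormalTo (hproj : projEd '' P' = P) (hG : ∀ x ∈ P, G x = ⟪m, x⟫_ℝ + b)
    (hnormal : IsNormalTo (WithLp.toLp 2 (m, -1) : Ed1 d) P') (hw : w ∈ P')
    (hwG : w.snd = G w.fst) : P' = graphOver G P := by
  have hfst : ∀ z ∈ P', z.fst ∈ P := fun z hz => hproj ▸ mem_image_of_mem projEd hz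
  have hsnd : ∀ z ∈ P', z.snd = G z.fst := fun z hz => by
    have horth := hnormal.2 _ (sub_mem_vectorSpan hw hz)
    rw [inner_sub_right, inner_toLp_prodMk, inner_toLp_prodMk, hwG, hG _ (hfst w hw)] at horth
    rw [hG _ (hfst z hz)]
    linarith
  refine Subset.antisymm (fun z hz => ⟨hfst z hz, hsnd z hz⟩) ?_
  rintro z ⟨hzP, hz⟩
  rw [← hproj] at hzP
  obtain ⟨y, hy, hyz : y.fst = z.fst⟩ := hzP
  rwa [← ext_Ed1 hyz (by rw [hsnd y hy, hz, hyz])]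

namespace IsAffineGluing

lemma normal_add_smul_embedEd (hgc : IsAffineGluing T s g c) (hadj : AdjacentCells T P Q)
    {n : Ed d} (hn : IsUnitNormalFromTo P Q n) :
    (WithLp.toLp 2 (g P, -1) : Ed1 d) + s (P ∩ Q) • embedEd n = WithLp.toLp 2 (g Q, -1) := by
  rw [hgc.step P Q hadj n hn]
  exact ext_Ed1 rfl (by simp [embedEd])

end IsAffineGluing

namespace IsGeneratrixFunction

lemma embedEd_image (hG : IsGeneratrixFunction T s g c G) (hP₀ : P₀ ∈ T) (hg₀ : g P₀ = 0)
    (hc₀ : c P₀ = 0) : embedEd '' P₀ = graphOver G P₀ := by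
  have hzero : ∀ x ∈ P₀, G x = 0 := fun x hx => by
    rw [hG.eq P₀ hP₀ x hx, hg₀, hc₀, inner_zero_left, add_zero]
  ext z
  constructor
  · rintro ⟨x, hx, rfl⟩
    exact ⟨hx, (hzero x hx).symm⟩
  · rintro ⟨hzP, hz⟩
    exact ⟨z.fst, hzP, ext_Ed1 rfl (hz.trans (hzero _ hzP)).symm⟩

lemma eq_graphOver_of_isChainLift (hG : IsGeneratrixFunction T s g c G) (hP₀ : P₀ ∈ T)
    (hg₀ : g P₀ = 0) (hc₀ : c P₀ = 0) (hchain : IsChainLift T s P₀ P P' h) :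
    P' = graphOver G P ∧ h = WithLp.toLp 2 (g P, -1) := by
  induction hchain with
  | base => exact ⟨hG.embedEd_image hP₀ hg₀ hc₀, by rw [hg₀]; rfl⟩
  | @step P Q P' Q' h n _ hadj hn hlift hnormal ih =>
    obtain ⟨rfl, rfl⟩ := ih
    rw [hG.normal_add_smul_embedEd hadj hn] at hnormal ⊢
    obtain ⟨⟨-, -, hproj⟩, -, -, hproj'⟩ := hlift
    obtain ⟨w, hwP, hwQ⟩ := image_nonempty.1 (hproj' ▸ hadj.nonempty)
    exact ⟨eq_graphOver_of_isNormalTo hproj (hG.eq Q hadj.2.1) hnormal hwQ hwP.2, rfl⟩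

lemma isLiftUpTo_graphOver (hG : IsGeneratrixFunction T s g c G) (hT : IsNormalTiling T)
    (hP : P ∈ T) (hQ : Q ∈ T) : IsLiftUpTo P (graphOver G P) Q (graphOver G Q) := by
  refine ⟨isLift_graphOver (hT.polyhedron Q hQ) (hG.eq Q hQ), ?_⟩
  rw [graphOver_inter]
  exact ⟨isExposed_graphOver (hT.faceToFace P hP Q hQ).1 G,
    isExposed_graphOver (hT.faceToFace P hP Q hQ).2 G, projEd_image_graphOver G _⟩

lemma isChainLift_graphOver (hG : IsGeneratrixFunction T s g c G) (hT : IsNormalTiling T)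
    (hP₀ : P₀ ∈ T) (hg₀ : g P₀ = 0) (hc₀ : c P₀ = 0) (hP : P ∈ T) :
    IsChainLift T s P₀ P (graphOver G P) (WithLp.toLp 2 (g P, -1)) := by
  have hne : ∀ Q ∈ T, (Q ∩ univ).Nonempty := fun Q hQ => by
    simpa only [inter_univ] using (hT.fullDim Q hQ).mono interior_subset
  refine hT.cell_induction_of_isOpen
    (Φ := fun P => IsChainLift T s P₀ P (graphOver G P) (WithLp.toLp 2 (g P, -1)))
    isOpen_univ convex_univ hP₀ hP (hne P₀ hP₀) (hne P hP) ?_ fun _ _ R hR S hS hadj hchain => ?_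
  · rw [← hG.embedEd_image hP₀ hg₀ hc₀, hg₀]
    exact IsChainLift.base
  · obtain ⟨n, hn⟩ := hT.exists_unitNormal hR.1 hS.1 hadj.2.2.1
    have hnormal := hG.normal_add_smul_embedEd hadj hn
    rw [← hnormal]
    refine hchain.step hadj hn (hG.isLiftUpTo_graphOver hT hR.1 hS.1) ?_
    rw [hnormal]
    exact isNormalTo_graphOver (hG.eq S hS.1)

lemma generatrixFaces_eq_singleton (hG : IsGeneratrixFunction T s g c G) (hT : IsNormalTiling T)
    (hP₀ : P₀ ∈ T) (hg₀ : g P₀ = 0) (hc₀ : c P₀ = 0) (hP : P ∈ T) :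
    generatrixFaces T s P₀ P = {graphOver G P} := by
  refine eq_singleton_iff_unique_mem.2 ⟨⟨_, hG.isChainLift_graphOver hT hP₀ hg₀ hc₀ hP⟩, ?_⟩
  rintro P' ⟨h, hchain⟩
  exact (hG.eq_graphOver_of_isChainLift hP₀ hg₀ hc₀ hchain).1

lemma generatrix_eq_graphOver (hG : IsGeneratrixFunction T s g c G) (hT : IsNormalTiling T)
    (hP₀ : P₀ ∈ T) (hg₀ : g P₀ = 0) (hc₀ : c P₀ = 0) :
    generatrix T s P₀ = graphOver G univ := by
  ext z
  constructor
  · rintro ⟨P, P', ⟨h, hchain⟩, hz⟩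
    rw [(hG.eq_graphOver_of_isChainLift hP₀ hg₀ hc₀ hchain).1] at hz
    exact ⟨trivial, hz.2⟩
  · rintro ⟨-, hz⟩
    obtain ⟨P, hP⟩ := hT.cellsAt_nonempty z.fst
    exact ⟨P, graphOver G P, ⟨_, hG.isChainLift_graphOver hT hP₀ hg₀ hc₀ hP.1⟩, hP.2, hz⟩

end IsGeneratrixFunction

end Lifts

section Epigraph

variable {d : ℕ} {T : Set (Set (Ed d))} {s : Set (Ed d) → ℝ} {g : Set (Ed d) → Ed d}
  {c : Set (Ed d) → ℝ} {G : Ed d → ℝ}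

lemma isClosed_epigraph (hG : Continuous G) : IsClosed (epigraph G) :=
  isClosed_le (hG.comp (WithLp.continuous_fst 2 _ _)) (WithLp.continuous_snd 2 _ _)

lemma interior_epigraph (hG : Continuous G) :
    interior (epigraph G) = {z : Ed1 d | G z.fst < z.snd} := by
  refine Subset.antisymm (fun z hz => ?_) <|
    interior_maximal (fun z (hz : G z.fst < z.snd) => hz.le) <|
      isOpen_lt (hG.comp (WithLp.continuous_fst 2 _ _)) (WithLp.continuous_snd 2 _ _)
  have hlower : Continuous fun ε : ℝ => (WithLp.toLp 2 (z.fst, z.snd - ε) : Ed1 d) := by fun_prop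
  have hnear : ∀ᶠ ε : ℝ in 𝓝 0, (WithLp.toLp 2 (z.fst, z.snd - ε) : Ed1 d) ∈ epigraph G :=
    (hlower.tendsto' 0 z (ext_Ed1 rfl (sub_zero _))).eventually (mem_interior_iff_mem_nhds.1 hz)
  obtain ⟨ε, hε, hε₀⟩ := ((hnear.filter_mono nhdsWithin_le_nhds).and
    (self_mem_nhdsWithin (s := Ioi (0 : ℝ)))).exists
  exact lt_of_le_of_lt hε (sub_lt_self _ hε₀)

lemma interior_epigraph_nonempty (hG : Continuous G) : (interior (epigraph G)).Nonempty := by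
  rw [interior_epigraph hG]
  exact ⟨WithLp.toLp 2 (0, G 0 + 1), lt_add_one (G 0)⟩

lemma frontier_epigraph (hG : Continuous G) : frontier (epigraph G) = graphOver G univ := by
  rw [frontier, (isClosed_epigraph hG).closure_eq, interior_epigraph hG]
  ext z
  simp only [epigraph, graphOver, Set.mem_sdiff, mem_ofPred_eq, not_lt, mem_univ, true_and]
  rw [← le_antisymm_iff, eq_comm]

lemma convex_epigraph (hG : ConvexOn ℝ univ G) : Convex ℝ (epigraph G) := by
  intro z (hz : G z.fst ≤ z.snd) w (hw : G w.fst ≤ w.snd) α β hα hβ hαβ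
  calc G (α • z.fst + β • w.fst) ≤ α • G z.fst + β • G w.fst :=
        hG.2 (mem_univ _) (mem_univ _) hα hβ hαβ
    _ ≤ α • z.snd + β • w.snd := by gcongr

lemma isConvexPolyhedron_setOf_forall_affine_le {ι : Type*} {S : Set ι} (hS : S.Finite)
    (g : ι → Ed d) (c : ι → ℝ) :
    IsConvexPolyhedron {z : Ed1 d | ∀ i ∈ S, ⟪g i, z.fst⟫_ℝ + c i ≤ z.snd} := by
  classical
  refine ⟨hS.toFinset.image fun i => (WithLp.toLp 2 (g i, -1), -c i), ?_⟩
  ext z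
  simp only [mem_ofPred_eq, Finset.mem_image, Finite.mem_toFinset, forall_exists_index, and_imp,
    forall_apply_eq_imp_iff₂, inner_toLp_prodMk]
  refine forall₂_congr fun i _ => ?_
  constructor <;> intro hi <;> linarith

namespace IsGeneratrixFunction

lemma isLocallyFiniteConvexPolyhedron (hG : IsGeneratrixFunction T s g c G)
    (hT : IsNormalTiling T) : IsLocallyFiniteConvexPolyhedron (epigraph G) := by
  refine ⟨isClosed_epigraph (hG.continuous hT), convex_epigraph (hG.convexOn hT), fun r => ?_⟩
  refine ⟨_, isConvexPolyhedron_setOf_forall_affine_le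
    (hT.locallyFinite.finite_nonempty_inter_compact (isCompact_closedBall (0 : Ed d) r))
    (fun P => g P) (fun P => c P), ?_⟩
  ext z
  refine and_congr_left fun hz => ⟨fun hGz P _ => (hG.le P P.2 _).trans hGz, fun hle => ?_⟩
  obtain ⟨P, hP⟩ := hT.cellsAt_nonempty z.fst
  have hzr : z.fst ∈ Metric.closedBall (0 : Ed d) r :=
    mem_closedBall_zero_iff.2 ((WithLp.norm_fst_le _ z).trans (mem_ball_zero_iff.1 hz).le)
  change G z.fst ≤ z.snd
  rw [hG.eq P hP.1 _ hP.2]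
  exact hle ⟨P, hP.1⟩ ⟨z.fst, hP.2, hzr⟩

end IsGeneratrixFunction

end Epigraph

theorem mainTheorem4 (d : ℕ) (T : Set (Set (Ed d))) (hT : IsNormalTiling T)
    (s : Set (Ed d) → ℝ) (hs : IsCanonicalScaling T s) (P₀ : Set (Ed d)) (hP₀ : P₀ ∈ T) :
    ∃ G : Ed d → ℝ,
      generatrix T s P₀ = graphOver G Set.univ ∧
      (∀ P ∈ T, generatrixFaces T s P₀ P = {graphOver G P}) ∧
      Continuous G ∧
      ConvexOn ℝ Set.univ G ∧
      (∀ P ∈ T, ∃ a : Ed d →ᵃ[ℝ] ℝ, Set.EqOn G a P) ∧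
      IsLocallyFiniteConvexPolyhedron (epigraph G) ∧
      (interior (epigraph G)).Nonempty ∧
      frontier (epigraph G) = generatrix T s P₀ := by
  obtain ⟨g, c, G, hg₀, hc₀, hG⟩ := hT.exists_isGeneratrixFunction hs P₀
  have hcont : Continuous G := hG.continuous hT
  have hgraph : generatrix T s P₀ = graphOver G univ :=
    hG.generatrix_eq_graphOver hT hP₀ hg₀ hc₀
  exact ⟨G, hgraph, fun P hP => hG.generatrixFaces_eq_singleton hT hP₀ hg₀ hc₀ hP, hcont,
    hG.convexOn hT, fun P hP => hG.exists_affineMap hP, hG.isLocallyFiniteConvexPolyhedron hT,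
    interior_epigraph_nonempty hcont, (frontier_epigraph hcont).trans hgraph.symm⟩
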